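/- Let $\mathbb K\in\{\mathbb R,\mathbb C\}$. Smoothness of maps between open subsets of Hausdorff locally convex $\mathbb K$-spaces is understood in the sense of Michal–Bastiani: $f$ is $C^1$ if it is continuous, all directional derivatives $df(x)(h)=\lim_{t\to 0}t^{-1}(f(x+th)-f(x))$ exist and $(x,h)\mapsto df(x)(h)$ is continuous; $f$ is $C^{n}$ if it is $C^1$ and $df$ is $C^{n-1}$; smooth means $C^n$ for all $n$. A Lie group is a group that is a smooth manifold modelled on a Hausdorff locally convex space with smooth multiplication and inversion. Let $G$ and $N$ be Lie groups, $Z(N)$ the center of $N$, $\mathrm{Aut}(N)$ the group of Lie group automorphisms of $N$, and $C_N(n)(x)=nxn^{-1}$. **Cochains.** $C^p_s(G,N)$ is the set of maps $f:G^p\to N$ that are smooth on a neighborhood of the identity and normalized ($f=\mathbf 1$ whenever one argument is $\mathbf 1$). $C^2_{ss}(G,N)$ is the set of those $\omega\in C^2_s(G,N)$ for which, for every $g\in G$, the map $x\mapsto \omega(g,x)\,\omega(gxg^{-1},g)^{-1}$ is smooth on an identity neighborhood of $G$. $C^p_s(G,Z(N))$ and $C^2_{ss}(G,Z(N))$ are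 the groups of the elements of $C^p_s(G,N)$, resp. $C^2_{ss}(G,N)$, with values in $Z(N)$. $C^1_s(G,\mathrm{Aut}(N))$ is the set of maps $S:G\to\mathrm{Aut}(N)$ with $S(\mathbf 1)=\mathrm{id}_N$ such that $(g,n)\mapsto S(g)(n)$ is smooth on $U\times N$ for some open identity neighborhood $U\subseteq G$. **Outer actions.** A smooth outer action of $G$ on $N$ is an $S\in C^1_s(G,\mathrm{Aut}(N))$ for which there is an $\omega\in C^2_s(G,N)$ with $S(g)S(g')S(gg')^{-1}=C_N(\omega(g,g'))$ for all $g,g'\in G$; it is strongly smooth if $\omega$ can be chosen in $C^2_{ss}(G,N)$. Write $S\sim S'$ if $S'(g)=C_N(h(g))S(g)$ for all $g\in G$, for some $h\in C^1_s(G,N)$; let $[S]$ be the class of $S$ for $\sim$ (the smooth $G$-kernel of $S$). **Characteristic class.** A smooth outer action $S$ turns $Z(N)$ into a $G$-module via $g.z=S(g)(z)$; let $d_S$ be the usual inhomogeneous group differential on $Z(N)$-valued cochains, and put $Z^3_s(G,Z(N))_S=\{f\in C^3_s(G,Z(N)) : d_Sf=\mathbf 1\}$, $$H^3_{s}(G,Z(N))_S=Z^3_s(G,Z(N))_S/d_S(C^2_{s}(G,Z(N))),\qquad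 H^3_{ss}(G,Z(N))_S=Z^3_s(G,Z(N))_S/d_S(C^2_{ss}(G,Z(N))),$$ the latter for strongly smooth $S$. For $\omega$ as in the definition of a (strongly) smooth outer action, the map $$(d_S\omega)(g,g',g'')=S(g)(\omega(g',g''))\,\omega(g,g'g'')\,\omega(gg',g'')^{-1}\,\omega(g,g')^{-1}$$ lies in $Z^3_s(G,Z(N))_S$. Its class $\chi_s(S)=[d_S\omega]\in H^3_s(G,Z(N))_S$ (with $\omega\in C^2_s(G,N)$), resp. $\chi_{ss}(S)=[d_S\omega]\in H^3_{ss}(G,Z(N))_S$ (with $\omega\in C^2_{ss}(G,N)$, for strongly smooth $S$), does not depend on the choice of $\omega$. **Extensions.** A Lie group extension of $G$ by $N$ is a short exact sequence of Lie group morphisms $\mathbf 1\to N\xrightarrow{\iota}\widehat G\xrightarrow{q}G\to\mathbf 1$ such that $q$ is a locally trivial smooth principal bundle for the right action of $N$ on $\widehat G$ through $\iota$. Two extensions are equivalent if there is a Lie group morphism between them that induces the identity on $N$ and on $G$. An extension corresponds to $[S]$ if, for a section $\sigma:G\to\widehat G$ of $q$ with $\sigma(\mathbf 1)=\mathbf 1$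 that is smooth on an identity neighborhood, the map $S'$ given by $\iota(S'(g)(n))=\sigma(g)\iota(n)\sigma(g)^{-1}$ satisfies $S'\sim S$. Let $\mathrm{Ext}(G,N)_{[S]}$ be the set of equivalence classes of Lie group extensions of $G$ by $N$ corresponding to $[S]$. **Theorem.** (1) If $S$ is a strongly smooth outer action of $G$ on $N$, then $$\chi_{ss}(S)=\mathbf 1\iff \mathrm{Ext}(G,N)_{[S]}\neq\emptyset .$$ (2) If $G$ is connected and $S$ is a smooth outer action of $G$ on $N$, then $$\chi_{s}(S)=\mathbf 1\iff \mathrm{Ext}(G,N)_{[S]}\neq\emptyset .$$ -/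

import Mathlib

universe u v w
open Set Filter Topology

/-- The directional derivative `df(x)(h) = lim_{t → 0} t⁻¹ (f (x + t h) - f x)` exists and
equals `y`. -/
def HasDirDerivAt (𝕜 : Type*) [RCLike 𝕜] {X Y : Type*} [AddCommGroup X] [Module 𝕜 X]
    [AddCommGroup Y] [Module 𝕜 Y] [TopologicalSpace Y] (f : X → Y) (x h : X) (y : Y) : Prop :=
  Tendsto (fun t : 𝕜 => t⁻¹ • (f (x + t • h) - f x)) (𝓝[≠] 0) (𝓝 y)

/-- `f` is `C^n` on the open set `U`: for `n = 0` it is continuous; for `n + 1` it is continuous,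
all directional derivatives exist at the points of `U`, and `(x, h) ↦ df(x)(h)` is `C^n` on
`U × X`. (For `n = 1` this says that `df` is continuous on `U × X`.) -/
def IsCk (𝕜 : Type*) [RCLike 𝕜] {Y : Type v} [AddCommGroup Y] [Module 𝕜 Y] [TopologicalSpace Y]
    (n : ℕ) {X : Type u} [AddCommGroup X] [Module 𝕜 X] [TopologicalSpace X]
    (f : X → Y) (U : Set X) : Prop :=
  match n with
  | 0 => ContinuousOn f U
  | n + 1 => ContinuousOn f U ∧ ∃ df : X × X → Y,
      (∀ x ∈ U, ∀ h, HasDirDerivAt 𝕜 f x h (df (x, h))) ∧ IsCk 𝕜 n df (U ×ˢ univ)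

section Calculus

variable {𝕜 : Type*} [RCLike 𝕜]
  {X : Type u} [AddCommGroup X] [Module 𝕜 X] [TopologicalSpace X]
  {Y : Type v} [AddCommGroup Y] [Module 𝕜 Y] [TopologicalSpace Y]
  {Z : Type w} [AddCommGroup Z] [Module 𝕜 Z] [TopologicalSpace Z]

theorem seminorm_sub_le_of_deriv [PolynormableSpace 𝕜 Z] {p : Seminorm 𝕜 Z} (hp : Continuous p)
    {γ γ' : ℝ → Z} {c : Z} {ε : ℝ}
    (hγ : ∀ s ∈ Icc (0 : ℝ) 1,
      Tendsto (fun r : ℝ => (r : 𝕜)⁻¹ • (γ (s + r) - γ s)) (𝓝[≠] 0) (𝓝 (γ' s)))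
    (hb : ∀ s ∈ Icc (0 : ℝ) 1, p (γ' s - c) ≤ ε) : p (γ 1 - γ 0 - c) ≤ ε := by
  set x₀ := γ 1 - γ 0 - c with hx₀
  obtain ⟨f, hf1, hf2⟩ : ∃ f : StrongDual 𝕜 Z, ‖f x₀‖ = p x₀ ∧ ∀ x, ‖f x‖ ≤ p x := by
    by_cases hx : x₀ = 0
    · exact ⟨0, by simp [hx], fun x => by simp⟩
    · obtain ⟨f, h1, h2⟩ := Module.Dual.exists_continuous_extension_of_le_seminorm
        (Submodule.span 𝕜 {x₀})
        (((p x₀ : ℝ) : 𝕜) • (LinearEquiv.toSpanNonzeroSingleton 𝕜 Z x₀ hx).symm.toLinearMap)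
        (p := p) hp (by
          rintro ⟨x, hxm⟩
          obtain ⟨a, rfl⟩ := Submodule.mem_span_singleton.1 hxm
          have : (⟨a • x₀, hxm⟩ : Submodule.span 𝕜 {x₀}) =
            LinearEquiv.toSpanNonzeroSingleton 𝕜 Z x₀ hx a := by
              ext; simp
          simp only [this, LinearMap.smul_apply, LinearEquiv.coe_coe, LinearEquiv.symm_apply_apply]
          simp [map_smul_eq_mul, mul_comm, abs_of_nonneg (apply_nonneg p x₀)])
      refine ⟨f, ?_, h2⟩
      have := h1 ⟨x₀, Submodule.mem_span_singleton_self x₀⟩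
      rw [← LinearEquiv.toSpanNonzeroSingleton_one 𝕜 Z x₀ hx] at this
      simp only [LinearMap.smul_apply, LinearEquiv.coe_coe, LinearEquiv.symm_apply_apply] at this
      simp at this
      rw [this]
      simp
  have key := norm_image_sub_le_of_norm_deriv_le_segment_01'
    (f := fun s : ℝ => f (γ s) - (s : 𝕜) * f c) (f' := fun s => f (γ' s) - f c) (C := ε) ?_ ?_
  · simp only [RCLike.ofReal_one, one_mul, RCLike.ofReal_zero, zero_mul, sub_zero] at key
    rw [← hf1, hx₀, map_sub]
    have e : f (γ 1) - f c - f (γ 0) = f (γ 1) - f (γ 0) - f c := by ring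
    rw [map_sub, ← e]
    exact key
  · intro s hs
    apply HasDerivAt.hasDerivWithinAt
    rw [hasDerivAt_iff_tendsto_slope_zero]
    have h := ((f.continuous.tendsto _).comp (hγ s hs)).sub_const (f c)
    refine h.congr' ?_
    filter_upwards [self_mem_nhdsWithin] with r hr
    have hr' : (r : 𝕜) ≠ 0 := by simpa using hr
    simp only [Function.comp, map_smul, map_sub, smul_eq_mul, RCLike.ofReal_add,
      RCLike.real_smul_eq_coe_mul, RCLike.ofReal_inv]
    field_simp
    ring
  · intro s hs
    rw [← map_sub]
    exact (hf2 _).trans (hb s ⟨hs.1, hs.2.le⟩)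

theorem HasDirDerivAt.comp [IsTopologicalAddGroup Y] [ContinuousSMul 𝕜 Y]
    [PolynormableSpace 𝕜 Z] {f : X → Y} {g : Y → Z} {dg : Y × Y → Z} {V : Set Y} {x h : X} {k : Y}
    (hV : IsOpen V) (hx : f x ∈ V) (hf : HasDirDerivAt 𝕜 f x h k)
    (hg : ∀ y ∈ V, ∀ k, HasDirDerivAt 𝕜 g y k (dg (y, k)))
    (hc : ContinuousOn dg (V ×ˢ univ)) : HasDirDerivAt 𝕜 (g ∘ f) x h (dg (f x, k)) := by
  have hp := PolynormableSpace.withSeminorms 𝕜 Z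
  unfold HasDirDerivAt
  rw [hp.tendsto_nhds]
  rintro ⟨p, hpc⟩ ε hε
  have hca : ContinuousAt dg (f x, k) :=
    hc.continuousAt ((hV.prod isOpen_univ).mem_nhds ⟨hx, mem_univ _⟩)
  have h1 : ∀ᶠ q in 𝓝 (f x, k), q.1 ∈ V ∧ p (dg q - dg (f x, k)) ≤ ε / 2 := by
    refine (continuous_fst.continuousAt.eventually (hV.mem_nhds hx)).and ?_
    have := hp.tendsto_nhds dg (f := 𝓝 (f x, k)) (dg (f x, k))
    filter_upwards [this.1 hca ⟨p, hpc⟩ (ε / 2) (by positivity)] with q hq using hq.le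
  have hm : Tendsto (fun q : 𝕜 × Y => (f x + q.1 • q.2, q.2)) (𝓝 ((0 : 𝕜), k)) (𝓝 (f x, k)) := by
    have : Continuous (fun q : 𝕜 × Y => (f x + q.1 • q.2, q.2)) := by fun_prop
    simpa using this.tendsto ((0 : 𝕜), k)
  have h2 := hm.eventually h1
  rw [nhds_prod_eq, eventually_prod_iff] at h2
  obtain ⟨pa, hpa, pb, hpb, hab⟩ := h2
  obtain ⟨δ, hδ, hball⟩ := Metric.eventually_nhds_iff.1 hpa
  have hsm : ∀ᶠ t : 𝕜 in 𝓝[≠] 0, dist t 0 < δ :=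
    nhdsWithin_le_nhds (Metric.ball_mem_nhds _ hδ)
  filter_upwards [hf.eventually hpb, hsm, self_mem_nhdsWithin] with t ht1 ht2 ht3
  have ht0 : t ≠ 0 := ht3
  set kt := t⁻¹ • (f (x + t • h) - f x) with hkt
  have hft : f (x + t • h) = f x + t • kt := by rw [hkt, smul_inv_smul₀ ht0]; abel
  have hin : ∀ r ∈ Icc (0 : ℝ) 1, f x + ((r : 𝕜) * t) • kt ∈ V ∧
      p (dg (f x + ((r : 𝕜) * t) • kt, kt) - dg (f x, k)) ≤ ε / 2 := by
    intro r hr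
    refine hab (x := (r : 𝕜) * t) ?_ ht1
    apply hball
    rw [dist_zero_right] at ht2 ⊢
    rw [norm_mul, RCLike.norm_ofReal, abs_of_nonneg hr.1]
    exact (mul_le_of_le_one_left (norm_nonneg _) hr.2).trans_lt ht2
  have := seminorm_sub_le_of_deriv hpc (γ := fun r : ℝ => t⁻¹ • g (f x + ((r : 𝕜) * t) • kt))
    (γ' := fun r => dg (f x + ((r : 𝕜) * t) • kt, kt)) (c := dg (f x, k)) (ε := ε / 2) ?_
    (fun r hr => (hin r hr).2)
  · simp only [RCLike.ofReal_one, one_mul, RCLike.ofReal_zero, zero_mul, zero_smul, add_zero] at this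
    rw [← hft, ← smul_sub] at this
    exact this.trans_lt (by linarith)
  · intro r hr
    have hd := hg _ (hin r hr).1 kt
    have htt : Tendsto (fun r' : ℝ => (r' : 𝕜) * t) (𝓝[≠] 0) (𝓝[≠] 0) := by
      refine tendsto_nhdsWithin_iff.2 ⟨?_, ?_⟩
      · have : Continuous (fun r' : ℝ => (r' : 𝕜) * t) := by fun_prop
        simpa using (this.tendsto 0).mono_left nhdsWithin_le_nhds
      · filter_upwards [self_mem_nhdsWithin] with r' hr'
        have : (r' : 𝕜) ≠ 0 := by simpa using hr'
        simpa using ⟨by simpa using hr', ht0⟩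
    refine (Tendsto.comp hd htt).congr fun r' => ?_
    simp only [Function.comp, mul_inv, RCLike.ofReal_add, add_mul, add_smul, ← add_assoc]
    rw [← smul_sub, ← smul_smul, ← smul_smul]

theorem IsCk.continuousOn {n : ℕ} {f : X → Y} {U : Set X} (h : IsCk 𝕜 n f U) :
    ContinuousOn f U := by
  cases n with
  | zero => exact h
  | succ n => exact h.1

theorem IsCk.mono {n : ℕ} {f : X → Y} {U V : Set X} (h : IsCk 𝕜 n f U) (hV : V ⊆ U) :
    IsCk 𝕜 n f V := by
  induction n generalizing X with
  | zero => exact ContinuousOn.mono h hV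
  | succ n ih =>
    obtain ⟨hc, df, hd, hdf⟩ := h
    exact ⟨hc.mono hV, df, fun x hx => hd x (hV hx), ih hdf (prod_mono hV subset_rfl)⟩

theorem IsCk.pred {n : ℕ} {f : X → Y} {U : Set X} (h : IsCk 𝕜 (n + 1) f U) : IsCk 𝕜 n f U := by
  induction n generalizing X with
  | zero => exact h.1
  | succ n ih =>
    obtain ⟨hc, df, hd, hdf⟩ := h
    exact ⟨hc, df, hd, ih hdf⟩

theorem HasDirDerivAt.congr [IsTopologicalAddGroup X] [ContinuousSMul 𝕜 X] {f g : X → Y}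
    {U : Set X} (hU : IsOpen U) (hfg : EqOn f g U) {x h : X} {y : Y} (hx : x ∈ U)
    (hf : HasDirDerivAt 𝕜 f x h y) : HasDirDerivAt 𝕜 g x h y := by
  refine Tendsto.congr' ?_ hf
  have : Tendsto (fun t : 𝕜 => x + t • h) (𝓝[≠] 0) (𝓝 x) := by
    have : Continuous (fun t : 𝕜 => x + t • h) := by fun_prop
    simpa using (this.tendsto 0).mono_left nhdsWithin_le_nhds
  filter_upwards [this.eventually (hU.mem_nhds hx)] with t ht
  rw [hfg ht, hfg hx]

theorem IsCk.congr [IsTopologicalAddGroup X] [ContinuousSMul 𝕜 X] {n : ℕ} {f g : X → Y}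
    {U : Set X} (hU : IsOpen U) (hfg : EqOn f g U) (hf : IsCk 𝕜 n f U) : IsCk 𝕜 n g U := by
  cases n with
  | zero => exact ContinuousOn.congr hf hfg.symm
  | succ n =>
    obtain ⟨hc, df, hd, hdf⟩ := hf
    exact ⟨hc.congr hfg.symm, df, fun x hx h => (hd x hx h).congr hU hfg hx, hdf⟩

theorem IsCk.of_local [IsTopologicalAddGroup X] [ContinuousSMul 𝕜 X] [T2Space Y]
    {n : ℕ} {f : X → Y} {U : Set X}
    (h : ∀ x ∈ U, ∃ V, IsOpen V ∧ x ∈ V ∧ IsCk 𝕜 n f V) : IsCk 𝕜 n f U := by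
  induction n generalizing X with
  | zero =>
    intro x hx
    obtain ⟨V, hV, hxV, hf⟩ := h x hx
    exact (ContinuousOn.continuousAt hf (hV.mem_nhds hxV)).continuousWithinAt
  | succ n ih =>
    classical
    refine ⟨?_, fun q => if hq : ∃ y, HasDirDerivAt 𝕜 f q.1 q.2 y then hq.choose else 0, ?_, ?_⟩
    · intro x hx
      obtain ⟨V, hV, hxV, hf⟩ := h x hx
      exact (hf.1.continuousAt (hV.mem_nhds hxV)).continuousWithinAt
    · intro x hx k
      obtain ⟨V, hV, hxV, hf, df, hd, -⟩ := h x hx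
      have hq : ∃ y, HasDirDerivAt 𝕜 f x k y := ⟨_, hd x hxV k⟩
      simp only [hq, dite_true]
      exact hq.choose_spec
    · apply ih
      rintro ⟨x, k⟩ ⟨hx, -⟩
      obtain ⟨V, hV, hxV, hf, df, hd, hdf⟩ := h x hx
      refine ⟨V ×ˢ univ, hV.prod isOpen_univ, ⟨hxV, mem_univ _⟩,
        hdf.congr (hV.prod isOpen_univ) ?_⟩
      rintro ⟨x', k'⟩ ⟨hx', -⟩
      have hq : ∃ y, HasDirDerivAt 𝕜 f x' k' y := ⟨_, hd x' hx' k'⟩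
      simp only [hq, dite_true]
      exact tendsto_nhds_unique (hd x' hx' k') hq.choose_spec

theorem IsCk.prodMk {n : ℕ} {f : X → Y} {g : X → Z} {U : Set X}
    (hf : IsCk 𝕜 n f U) (hg : IsCk 𝕜 n g U) : IsCk 𝕜 n (fun x => (f x, g x)) U := by
  induction n generalizing X with
  | zero => exact ContinuousOn.prodMk hf hg
  | succ n ih =>
    obtain ⟨hc, df, hd, hdf⟩ := hf
    obtain ⟨hc', dg, hd', hdg⟩ := hg
    exact ⟨hc.prodMk hc', fun q => (df q, dg q),
      fun x hx h => (hd x hx h).prodMk_nhds (hd' x hx h), ih hdf hdg⟩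

theorem ContinuousLinearMap.isCk (n : ℕ) (L : X →L[𝕜] Y) (U : Set X) : IsCk 𝕜 n L U := by
  induction n generalizing X with
  | zero => exact L.continuous.continuousOn
  | succ n ih =>
    refine ⟨L.continuous.continuousOn, L.comp (ContinuousLinearMap.snd 𝕜 X X), fun x _ h => ?_,
      ih _ _⟩
    refine Tendsto.congr' ?_ tendsto_const_nhds
    filter_upwards [self_mem_nhdsWithin] with t ht
    simp [inv_smul_smul₀ (show t ≠ 0 from ht)]

theorem isCk_const (n : ℕ) (c : Y) (U : Set X) : IsCk 𝕜 n (fun _ : X => c) U := by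
  induction n generalizing X c with
  | zero => exact continuousOn_const
  | succ n ih =>
    refine ⟨continuousOn_const, fun _ => 0, fun x _ h => ?_, ih _ _⟩
    simpa [HasDirDerivAt] using tendsto_const_nhds

theorem IsCk.comp_clm {W : Type*} [AddCommGroup W] [Module 𝕜 W] [TopologicalSpace W]
    {n : ℕ} {f : X → Y} {U : Set X} (hf : IsCk 𝕜 n f U) (L : W →L[𝕜] X) :
    IsCk 𝕜 n (f ∘ L) (L ⁻¹' U) := by
  induction n generalizing X W with
  | zero => exact ContinuousOn.comp hf L.continuous.continuousOn fun _ h => h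
  | succ n ih =>
    obtain ⟨hc, df, hd, hdf⟩ := hf
    refine ⟨hc.comp L.continuous.continuousOn fun _ h => h, df ∘ (L.prodMap L),
      fun x hx h => ?_, ?_⟩
    · refine Tendsto.congr (fun t => ?_) (hd (L x) hx (L h))
      simp
    · exact (ih hdf (L.prodMap L)).mono fun q hq => ⟨hq.1, mem_univ _⟩

theorem IsCk.comp [IsTopologicalAddGroup X] [ContinuousSMul 𝕜 X] [IsTopologicalAddGroup Y]
    [ContinuousSMul 𝕜 Y] [PolynormableSpace 𝕜 Z] {n : ℕ} {f : X → Y} {g : Y → Z}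
    {U : Set X} {V : Set Y} (hU : IsOpen U) (hV : IsOpen V) (hUV : MapsTo f U V)
    (hg : IsCk 𝕜 n g V) (hf : IsCk 𝕜 n f U) : IsCk 𝕜 n (g ∘ f) U := by
  induction n generalizing X Y with
  | zero => exact ContinuousOn.comp hg hf hUV
  | succ n ih =>
    have hf' := hf.pred
    obtain ⟨hc, df, hd, hdf⟩ := hf
    obtain ⟨hc', dg, hd', hdg⟩ := hg
    refine ⟨hc'.comp hc hUV, dg ∘ fun q => (f q.1, df q), fun x hx h =>
      (hd x hx h).comp hV (hUV hx) hd' hdg.continuousOn, ?_⟩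
    refine ih (hU.prod isOpen_univ) (hV.prod isOpen_univ) ?_ hdg (IsCk.prodMk ?_ hdf)
    · rintro ⟨x, h⟩ ⟨hx, -⟩
      exact ⟨hUV hx, mem_univ _⟩
    · exact (hf'.comp_clm (ContinuousLinearMap.fst 𝕜 X X)).mono fun q hq => hq.1
end Calculus

section Manifolds

/-- Smooth, i.e. `C^n` for all `n`, on the open set `U`. -/
def IsSmoothOn (𝕜 : Type*) [RCLike 𝕜] {X Y : Type*} [AddCommGroup X] [Module 𝕜 X]
    [TopologicalSpace X] [AddCommGroup Y] [Module 𝕜 Y] [TopologicalSpace Y]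
    (f : X → Y) (U : Set X) : Prop :=
  ∀ n : ℕ, IsCk 𝕜 n f U

/-- The charts of the atlas modelled on `E` are smoothly compatible. -/
class IsSmoothManifold (𝕜 : Type*) [RCLike 𝕜] (E : Type*) [AddCommGroup E] [Module 𝕜 E]
    [TopologicalSpace E] (M : Type*) [TopologicalSpace M] [ChartedSpace E M] : Prop where
  compat : ∀ e ∈ atlas E M, ∀ e' ∈ atlas E M,
    IsSmoothOn 𝕜 (e' ∘ e.symm) (e.target ∩ e.symm ⁻¹' e'.source)

/-- The product of two manifolds is modelled on the product of the model spaces. -/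
instance productChartedSpace (E : Type*) [TopologicalSpace E] (M : Type*) [TopologicalSpace M]
    [ChartedSpace E M] (E' : Type*) [TopologicalSpace E'] (M' : Type*) [TopologicalSpace M']
    [ChartedSpace E' M'] : ChartedSpace (E × E') (M × M') :=
  prodChartedSpace E M E' M'

/-- `f : M → M'` is smooth on the open set `W`: continuous on `W`, and smooth in all charts. -/
def MSmoothOn (𝕜 : Type*) [RCLike 𝕜] (E E' : Type*) [AddCommGroup E] [Module 𝕜 E]
    [TopologicalSpace E] [AddCommGroup E'] [Module 𝕜 E'] [TopologicalSpace E']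
    {M M' : Type*} [TopologicalSpace M] [ChartedSpace E M] [TopologicalSpace M']
    [ChartedSpace E' M'] (f : M → M') (W : Set M) : Prop :=
  ContinuousOn f W ∧ ∀ e ∈ atlas E M, ∀ e' ∈ atlas E' M',
    IsSmoothOn 𝕜 (e' ∘ f ∘ e.symm) (e.target ∩ e.symm ⁻¹' (W ∩ f ⁻¹' e'.source))

variable {𝕜 : Type*} [RCLike 𝕜]
  {E : Type*} [AddCommGroup E] [Module 𝕜 E] [TopologicalSpace E]
  {E' : Type*} [AddCommGroup E'] [Module 𝕜 E'] [TopologicalSpace E']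
  {E'' : Type*} [AddCommGroup E''] [Module 𝕜 E''] [TopologicalSpace E'']
  {M : Type*} [TopologicalSpace M] [ChartedSpace E M]
  {M' : Type*} [TopologicalSpace M'] [ChartedSpace E' M']
  {M'' : Type*} [TopologicalSpace M''] [ChartedSpace E'' M'']

theorem mem_atlas_prod {c : OpenPartialHomeomorph (M × M') (E × E')} :
    c ∈ atlas (E × E') (M × M') ↔ ∃ e ∈ atlas E M, ∃ e' ∈ atlas E' M', e.prod e' = c :=
  Iff.rfl

theorem MSmoothOn.mono {f : M → M'} {W W' : Set M} (h : MSmoothOn 𝕜 E E' f W) (hW : W' ⊆ W) :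
    MSmoothOn 𝕜 E E' f W' :=
  ⟨h.1.mono hW, fun e he e' he' n => (h.2 e he e' he' n).mono
    (inter_subset_inter_right _ (preimage_mono (inter_subset_inter_left _ hW)))⟩

theorem MSmoothOn.congr [IsTopologicalAddGroup E] [ContinuousSMul 𝕜 E] {f g : M → M'} {W : Set M}
    (h : MSmoothOn 𝕜 E E' f W) (hW : IsOpen W) (hfg : EqOn f g W) : MSmoothOn 𝕜 E E' g W := by
  have hc := h.1.congr hfg.symm
  refine ⟨hc, fun e he e' he' n => ?_⟩
  refine ((h.2 e he e' he' n).mono ?_).congr ?_ ?_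
  · rintro x ⟨hx, hxW, hx'⟩
    refine ⟨hx, hxW, ?_⟩
    simpa [mem_preimage, hfg hxW] using hx'
  · exact e.symm.isOpen_inter_preimage (hc.isOpen_inter_preimage hW e'.open_source)
  · rintro x ⟨hx, hxW, hx'⟩
    simp [hfg hxW]

theorem MSmoothOn.comp [IsTopologicalAddGroup E] [ContinuousSMul 𝕜 E] [IsTopologicalAddGroup E']
    [ContinuousSMul 𝕜 E'] [PolynormableSpace 𝕜 E''] [T2Space E''] {f : M → M'} {g : M' → M''}
    {W : Set M} {W' : Set M'} (hg : MSmoothOn 𝕜 E' E'' g W') (hf : MSmoothOn 𝕜 E E' f W)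
    (hW : IsOpen W) (hW' : IsOpen W') (hm : MapsTo f W W') : MSmoothOn 𝕜 E E'' (g ∘ f) W := by
  have hc := hg.1.comp hf.1 hm
  refine ⟨hc, fun e he e'' he'' n => IsCk.of_local ?_⟩
  rintro x ⟨hx, hxW, hx''⟩
  set e' := chartAt E' (f (e.symm x)) with he'
  have hs : f (e.symm x) ∈ e'.source := mem_chart_source E' _
  set O : Set E := e.target ∩ e.symm ⁻¹' ((W ∩ (g ∘ f) ⁻¹' e''.source) ∩ (W ∩ f ⁻¹' e'.source))
    with hO
  have hOo : IsOpen O := e.symm.isOpen_inter_preimage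
    ((hc.isOpen_inter_preimage hW e''.open_source).inter
      (hf.1.isOpen_inter_preimage hW e'.open_source))
  refine ⟨O, hOo, ⟨hx, ⟨hxW, hx''⟩, hxW, hs⟩, ?_⟩
  have h1 : IsCk 𝕜 n (e' ∘ f ∘ e.symm) O := (hf.2 e he e' (chart_mem_atlas _ _) n).mono
    fun y hy => ⟨hy.1, hy.2.2⟩
  have h2 := hg.2 e' (chart_mem_atlas _ _) e'' he'' n
  have h3 := IsCk.comp hOo (e'.symm.isOpen_inter_preimage
    (hg.1.isOpen_inter_preimage hW' e''.open_source)) ?_ h2 h1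
  · refine h3.congr hOo ?_
    rintro y ⟨hy, -, -, hy'⟩
    simp only [Function.comp]
    rw [e'.left_inv hy']
  · rintro y ⟨hy, ⟨hyW, hy''⟩, -, hy'⟩
    refine ⟨e'.map_source hy', ?_⟩
    simp only [mem_preimage, Function.comp] at hy' hy'' ⊢
    rw [e'.left_inv hy']
    exact ⟨hm hyW, hy''⟩

theorem MSmoothOn.prodMk {f : M → M'} {g : M → M''} {W : Set M} (hf : MSmoothOn 𝕜 E E' f W)
    (hg : MSmoothOn 𝕜 E E'' g W) : MSmoothOn 𝕜 E (E' × E'') (fun x => (f x, g x)) W := by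
  refine ⟨hf.1.prodMk hg.1, fun e he c hc n => ?_⟩
  obtain ⟨e', he', e'', he'', rfl⟩ := mem_atlas_prod.1 hc
  exact ((hf.2 e he e' he' n).mono fun y hy => ⟨hy.1, hy.2.1, hy.2.2.1⟩).prodMk
    ((hg.2 e he e'' he'' n).mono fun y hy => ⟨hy.1, hy.2.1, hy.2.2.2⟩)

theorem mSmoothOn_id [IsSmoothManifold 𝕜 E M] (W : Set M) : MSmoothOn 𝕜 E E (id : M → M) W :=
  ⟨continuousOn_id, fun e he e' he' n => (IsSmoothManifold.compat e he e' he' n).mono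
    fun _ hy => ⟨hy.1, hy.2.2⟩⟩

theorem mSmoothOn_const (c : M') (W : Set M) : MSmoothOn 𝕜 E E' (fun _ : M => c) W :=
  ⟨continuousOn_const, fun _ _ e' _ n => isCk_const n (e' c) _⟩

theorem mSmoothOn_fst [IsSmoothManifold 𝕜 E M] (W : Set (M × M')) :
    MSmoothOn 𝕜 (E × E') E (Prod.fst : M × M' → M) W := by
  refine ⟨continuousOn_fst, fun c hc e₂ he₂ n => ?_⟩
  obtain ⟨e, he, e', he', rfl⟩ := mem_atlas_prod.1 hc
  exact ((IsSmoothManifold.compat (𝕜 := 𝕜) e he e₂ he₂ n).comp_clm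
    (ContinuousLinearMap.fst 𝕜 E E')).mono fun y hy => ⟨hy.1.1, hy.2.2⟩

theorem mSmoothOn_snd [IsSmoothManifold 𝕜 E' M'] (W : Set (M × M')) :
    MSmoothOn 𝕜 (E × E') E' (Prod.snd : M × M' → M') W := by
  refine ⟨continuousOn_snd, fun c hc e₂ he₂ n => ?_⟩
  obtain ⟨e, he, e', he', rfl⟩ := mem_atlas_prod.1 hc
  exact ((IsSmoothManifold.compat (𝕜 := 𝕜) e' he' e₂ he₂ n).comp_clm
    (ContinuousLinearMap.snd 𝕜 E E')).mono fun y hy => ⟨hy.1.2, hy.2.2⟩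

end Manifolds

section LieGroups

instance productIsSmoothManifold (𝕜 : Type*) [RCLike 𝕜]
    (E : Type*) [AddCommGroup E] [Module 𝕜 E] [TopologicalSpace E]
    (E' : Type*) [AddCommGroup E'] [Module 𝕜 E'] [TopologicalSpace E']
    (M : Type*) [TopologicalSpace M] [ChartedSpace E M] [IsSmoothManifold 𝕜 E M]
    (M' : Type*) [TopologicalSpace M'] [ChartedSpace E' M'] [IsSmoothManifold 𝕜 E' M'] :
    IsSmoothManifold 𝕜 (E × E') (M × M') where
  compat c hc c' hc' n := by
    obtain ⟨e₁, h₁, e₂, h₂, rfl⟩ := mem_atlas_prod.1 hc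
    obtain ⟨e₁', h₁', e₂', h₂', rfl⟩ := mem_atlas_prod.1 hc'
    exact (((IsSmoothManifold.compat (𝕜 := 𝕜) e₁ h₁ e₁' h₁' n).comp_clm
      (ContinuousLinearMap.fst 𝕜 E E')).mono fun y hy => ⟨hy.1.1, hy.2.1⟩).prodMk
      (((IsSmoothManifold.compat (𝕜 := 𝕜) e₂ h₂ e₂' h₂' n).comp_clm
      (ContinuousLinearMap.snd 𝕜 E E')).mono fun y hy => ⟨hy.1.2, hy.2.2⟩)

/-- A group that is a smooth manifold modelled on `E` with smooth multiplication and inversion.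
Wherever it is used, `E` is a Hausdorff locally convex space. -/
class IsLieGroup (𝕜 : Type*) [RCLike 𝕜] (E : Type*) [AddCommGroup E] [Module 𝕜 E]
    [TopologicalSpace E] (G : Type*) [Group G] [TopologicalSpace G] [ChartedSpace E G] : Prop
    extends IsSmoothManifold 𝕜 E G where
  smooth_mul : MSmoothOn 𝕜 (E × E) E (fun p : G × G => p.1 * p.2) univ
  smooth_inv : MSmoothOn 𝕜 E E (fun g : G => g⁻¹) univ

/-- `f` is smooth on some open neighbourhood of `1`. -/
def LocallySmooth (𝕜 : Type*) [RCLike 𝕜] (E E' : Type*) [AddCommGroup E] [Module 𝕜 E]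
    [TopologicalSpace E] [AddCommGroup E'] [Module 𝕜 E'] [TopologicalSpace E']
    {M M' : Type*} [One M] [TopologicalSpace M] [ChartedSpace E M] [TopologicalSpace M']
    [ChartedSpace E' M'] (f : M → M') : Prop :=
  ∃ U : Set M, IsOpen U ∧ 1 ∈ U ∧ MSmoothOn 𝕜 E E' f U

section LocallySmooth

variable {𝕜 : Type*} [RCLike 𝕜]
  {E : Type*} [AddCommGroup E] [Module 𝕜 E] [TopologicalSpace E]
  {E' : Type*} [AddCommGroup E'] [Module 𝕜 E'] [TopologicalSpace E']
  {E'' : Type*} [AddCommGroup E''] [Module 𝕜 E''] [TopologicalSpace E'']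
  {M : Type*} [One M] [TopologicalSpace M] [ChartedSpace E M]
  {M' : Type*} [TopologicalSpace M'] [ChartedSpace E' M']
  {M'' : Type*} [TopologicalSpace M''] [ChartedSpace E'' M'']

theorem MSmoothOn.locallySmooth {f : M → M'} (h : MSmoothOn 𝕜 E E' f univ) :
    LocallySmooth 𝕜 E E' f :=
  ⟨univ, isOpen_univ, mem_univ _, h⟩

theorem LocallySmooth.comp [One M'] [IsTopologicalAddGroup E] [ContinuousSMul 𝕜 E]
    [IsTopologicalAddGroup E'] [ContinuousSMul 𝕜 E'] [PolynormableSpace 𝕜 E''] [T2Space E'']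
    {g : M' → M''} {f : M → M'} (hg : LocallySmooth 𝕜 E' E'' g) (hf : LocallySmooth 𝕜 E E' f)
    (h1 : f 1 = 1) : LocallySmooth 𝕜 E E'' (fun x => g (f x)) := by
  obtain ⟨V, hV, h1V, hg⟩ := hg
  obtain ⟨U, hU, h1U, hf⟩ := hf
  have hO := hf.1.isOpen_inter_preimage hU hV
  exact ⟨U ∩ f ⁻¹' V, hO, ⟨h1U, by simpa [h1] using h1V⟩,
    hg.comp (hf.mono inter_subset_left) hO hV fun x hx => hx.2⟩

theorem LocallySmooth.prodMk {f : M → M'} {g : M → M''} (hf : LocallySmooth 𝕜 E E' f)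
    (hg : LocallySmooth 𝕜 E E'' g) : LocallySmooth 𝕜 E (E' × E'') (fun x => (f x, g x)) := by
  obtain ⟨V, hV, h1V, hg⟩ := hg
  obtain ⟨U, hU, h1U, hf⟩ := hf
  exact ⟨U ∩ V, hU.inter hV, ⟨h1U, h1V⟩,
    (hf.mono inter_subset_left).prodMk (hg.mono inter_subset_right)⟩

variable {N : Type*} [Group N] [TopologicalSpace N] [ChartedSpace E' N] [IsLieGroup 𝕜 E' N]
  [IsTopologicalAddGroup E] [ContinuousSMul 𝕜 E] [IsTopologicalAddGroup E'] [ContinuousSMul 𝕜 E']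
  [PolynormableSpace 𝕜 E'] [T2Space E']

theorem MSmoothOn.locallySmooth_comp {W : Type*} [One W] [TopologicalSpace W] [ChartedSpace E W]
    {g : M' → M''} {f : W → M'} [PolynormableSpace 𝕜 E''] [T2Space E'']
    (hg : MSmoothOn 𝕜 E' E'' g univ) (hf : LocallySmooth 𝕜 E E' f) :
    LocallySmooth 𝕜 E E'' (fun x => g (f x)) := by
  obtain ⟨U, hU, h1U, hf⟩ := hf
  exact ⟨U, hU, h1U, hg.comp hf hU isOpen_univ (mapsTo_univ _ _)⟩

theorem LocallySmooth.mul {f g : M → N} (hf : LocallySmooth 𝕜 E E' f)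
    (hg : LocallySmooth 𝕜 E E' g) : LocallySmooth 𝕜 E E' (fun x => f x * g x) :=
  (IsLieGroup.smooth_mul (𝕜 := 𝕜) (E := E') (G := N)).locallySmooth_comp (hf.prodMk hg)

theorem LocallySmooth.inv {f : M → N} (hf : LocallySmooth 𝕜 E E' f) :
    LocallySmooth 𝕜 E E' (fun x => (f x)⁻¹) :=
  (IsLieGroup.smooth_inv (𝕜 := 𝕜) (E := E') (G := N)).locallySmooth_comp hf

end LocallySmooth

end LieGroups

/-- `δ_f(g, g') = f(g) f(g') f(gg')⁻¹`. -/
def deltaMap {G H : Type*} [Group G] [Group H] (f : G → H) (g g' : G) : H :=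
  f g * f g' * (f (g * g'))⁻¹

/-- `(d_S ω)(g, g', g'') = S(g)(ω(g', g'')) ω(g, g'g'') ω(gg', g'')⁻¹ ω(g, g')⁻¹`. -/
def dCochain {G N : Type*} [Group G] [Group N] (S : G → MulAut N) (ω : G → G → N)
    (g g' g'' : G) : N :=
  S g (ω g' g'') * ω g (g' * g'') * (ω (g * g') g'')⁻¹ * (ω g g')⁻¹

section Algebra

variable {G N : Type*} [Group G] [Group N] {S : G → MulAut N} {ω : G → G → N}

theorem conj_lift_apply (h : ∀ a b, deltaMap S a b = MulAut.conj (ω a b)) (a b : G) (n : N) :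
    S a (S b n) = ω a b * S (a * b) n * (ω a b)⁻¹ := by
  have h' : S a * S b = MulAut.conj (ω a b) * S (a * b) := by
    rw [← h, deltaMap, inv_mul_cancel_right]
  simpa using DFunLike.congr_fun h' n

theorem dCochain_rel (S : G → MulAut N) (ω : G → G → N) (a b c : G) :
    S a (ω b c) * ω a (b * c) = dCochain S ω a b c * ω a b * ω (a * b) c := by
  simp [dCochain]

theorem dCochain_mem_center (h : ∀ a b, deltaMap S a b = MulAut.conj (ω a b)) (a b c : G) :
    dCochain S ω a b c ∈ Subgroup.center N := by
  rw [Subgroup.mem_center_iff]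
  intro n
  have hs : ∀ m, S a (ω b c) * ω a (b * c) * S (a * (b * c)) m
      = ω a b * (ω (a * b) c * S (a * (b * c)) m * (ω (a * b) c)⁻¹) * (ω a b)⁻¹ *
        (S a (ω b c) * ω a (b * c)) := by
    intro m
    have h1 : S a (S b (S c m)) = S a (ω b c) * ω a (b * c) * S (a * (b * c)) m *
        (ω a (b * c))⁻¹ * (S a (ω b c))⁻¹ := by
      rw [conj_lift_apply h b c, map_mul, map_mul, map_inv, conj_lift_apply h a (b * c)]
      group
    have h2 : S a (S b (S c m)) =
        ω a b * (ω (a * b) c * S (a * (b * c)) m * (ω (a * b) c)⁻¹) * (ω a b)⁻¹ := by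
      rw [conj_lift_apply h a b, conj_lift_apply h (a * b) c, mul_assoc a b c]
    rw [← h2, h1]
    group
  obtain ⟨m, hm⟩ := (S (a * (b * c))).surjective ((ω (a * b) c)⁻¹ * (ω a b)⁻¹ * n * ω a b *
    ω (a * b) c)
  have := hs m
  rw [hm, dCochain_rel] at this
  set F := dCochain S ω a b c
  have e1 : F * ω a b * ω (a * b) c *
      ((ω (a * b) c)⁻¹ * (ω a b)⁻¹ * n * ω a b * ω (a * b) c) =
      F * n * (ω a b * ω (a * b) c) := by group
  have e2 : ω a b * (ω (a * b) c * ((ω (a * b) c)⁻¹ * (ω a b)⁻¹ * n * ω a b * ω (a * b) c) *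
      (ω (a * b) c)⁻¹) * (ω a b)⁻¹ * (F * ω a b * ω (a * b) c) =
      n * F * (ω a b * ω (a * b) c) := by group
  rw [e1, e2] at this
  exact (mul_right_cancel this).symm

theorem dCochain_cocycle (h : ∀ a b, deltaMap S a b = MulAut.conj (ω a b)) (a b c d : G) :
    S a (dCochain S ω b c d) * dCochain S ω a (b * c) d * dCochain S ω a b c =
      dCochain S ω a b (c * d) * dCochain S ω (a * b) c d := by
  have hc : ∀ x y z n, n * dCochain S ω x y z = dCochain S ω x y z * n := fun x y z n =>
    Subgroup.mem_center_iff.1 (dCochain_mem_center h x y z) n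
  have way1 : S a (S b (ω c d) * ω b (c * d)) * ω a (b * (c * d)) =
      S a (dCochain S ω b c d) * dCochain S ω a (b * c) d * dCochain S ω a b c *
        (ω a b * ω (a * b) c * ω (a * b * c) d) := by
    rw [dCochain_rel, map_mul, map_mul, ← mul_assoc b c d, mul_assoc, dCochain_rel S ω a (b * c) d,
      mul_assoc, mul_assoc (S a _), ← mul_assoc (S a (ω b c)), ← mul_assoc (S a (ω b c)), hc,
      mul_assoc (dCochain S ω a (b * c) d), dCochain_rel S ω a b c, mul_assoc a b c]
    simp only [mul_assoc]
  have way2 : S a (S b (ω c d) * ω b (c * d)) * ω a (b * (c * d)) =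
      dCochain S ω a b (c * d) * dCochain S ω (a * b) c d *
        (ω a b * ω (a * b) c * ω (a * b * c) d) := by
    rw [map_mul, mul_assoc, dCochain_rel, conj_lift_apply h a b]
    have h3 := dCochain_rel S ω (a * b) c d
    have e : ω a b * S (a * b) (ω c d) * (ω a b)⁻¹ *
        (dCochain S ω a b (c * d) * ω a b * ω (a * b) (c * d)) =
        dCochain S ω a b (c * d) * (ω a b * (S (a * b) (ω c d) * ω (a * b) (c * d))) := by
      rw [mul_assoc (dCochain S ω a b (c * d)), ← mul_assoc _ (dCochain S ω a b (c * d)), hc]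
      group
    rw [e, h3, mul_assoc (dCochain S ω (a * b) c d), ← mul_assoc (ω a b), hc]
    simp only [mul_assoc]
  exact mul_right_cancel (way1.symm.trans way2)

theorem dCochain_mul_central {β : G → G → N} (hβ : ∀ a b, β a b ∈ Subgroup.center N)
    (a b c : G) : dCochain S (fun x y => ω x y * β x y) a b c =
      dCochain S ω a b c * dCochain S β a b c := by
  have hc : ∀ x y n, β x y * n = n * β x y := fun x y n =>
    (Subgroup.mem_center_iff.1 (hβ x y) n).symm
  have hs : ∀ n, S a (β b c) * n = n * S a (β b c) := fun n => by
    obtain ⟨m, rfl⟩ := (S a).surjective n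
    rw [← map_mul, hc, map_mul]
  have hi : ∀ x y n, (β x y)⁻¹ * n = n * (β x y)⁻¹ := fun x y n => by
    rw [inv_mul_eq_iff_eq_mul, ← mul_assoc, hc, mul_inv_cancel_right]
  simp only [dCochain, map_mul, mul_inv_rev, mul_assoc]
  have h2 := hc a (b * c)
  have h3 := hi (a * b) c
  have h4 := hi a b
  generalize S a (β b c) = z₁ at *
  generalize β a (b * c) = z₂ at *
  generalize (β (a * b) c)⁻¹ = z₃ at *
  generalize (β a b)⁻¹ = z₄ at *
  generalize (ω a b)⁻¹ = t at *
  generalize (ω (a * b) c)⁻¹ = r at *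
  rw [h4 t, h3 (r * _), h2 (_ * z₃), hs (_ * _), hs (z₂ * _), h2 (z₃ * _), h3 z₄]
  simp only [mul_assoc]

end Algebra


section LocallySmoothCochains

variable (𝕜 : Type*) [RCLike 𝕜]
  (E : Type*) [AddCommGroup E] [Module 𝕜 E] [TopologicalSpace E]
  (F : Type*) [AddCommGroup F] [Module 𝕜 F] [TopologicalSpace F]
  {G : Type*} [Group G] [TopologicalSpace G] [ChartedSpace E G]
  {N : Type*} [Group N] [TopologicalSpace N] [ChartedSpace F N]

/-- `f ∈ C¹_s(G, N)`: normalized and locally smooth. -/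
structure IsC1 (f : G → N) : Prop where
  map_one : f 1 = 1
  locallySmooth : LocallySmooth 𝕜 E F f

/-- `f ∈ C²_s(G, N)`: normalized and locally smooth. -/
structure IsC2 (f : G → G → N) : Prop where
  one_left : ∀ g, f 1 g = 1
  one_right : ∀ g, f g 1 = 1
  locallySmooth : LocallySmooth 𝕜 (E × E) F (fun p : G × G => f p.1 p.2)

/-- `f ∈ C²_ss(G, N)`: in addition, for each `g` the map `x ↦ f(g, x) f(gxg⁻¹, g)⁻¹` is smooth
in an identity neighbourhood. -/
structure IsC2ss (f : G → G → N) : Prop extends IsC2 𝕜 E F f where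
  locallySmooth_twist : ∀ g, LocallySmooth 𝕜 E F (fun x => f g x * (f (g * x * g⁻¹) g)⁻¹)

/-- `f ∈ C³_s(G, N)`: normalized and locally smooth. -/
structure IsC3 (f : G → G → G → N) : Prop where
  one_left : ∀ g g', f 1 g g' = 1
  one_mid : ∀ g g', f g 1 g' = 1
  one_right : ∀ g g', f g g' 1 = 1
  locallySmooth : LocallySmooth 𝕜 (E × E × E) F (fun p : G × G × G => f p.1 p.2.1 p.2.2)

/-- `φ` belongs to the group `Aut(N)` of Lie group automorphisms of `N`. -/
def IsLieAut (φ : MulAut N) : Prop :=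
  MSmoothOn 𝕜 F F (fun n => φ n) univ ∧ MSmoothOn 𝕜 F F (fun n => φ⁻¹ n) univ

/-- `S ∈ C¹_s(G, Aut(N))`. -/
structure IsC1Aut (S : G → MulAut N) : Prop where
  isLieAut : ∀ g, IsLieAut 𝕜 F (S g)
  map_one : S 1 = 1
  smooth_near_one : ∃ U : Set G, IsOpen U ∧ 1 ∈ U ∧
    MSmoothOn 𝕜 (E × F) F (fun p : G × N => S p.1 p.2) (U ×ˢ univ)

/-- `S ∈ C¹_s(G, Aut(N))` with `δ_S = C_N ∘ ω` for some `ω ∈ C²_s(G, N)`. -/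
structure IsSmoothOuterAction (S : G → MulAut N) : Prop where
  isC1Aut : IsC1Aut 𝕜 E F S
  exists_lift : ∃ ω : G → G → N, IsC2 𝕜 E F ω ∧
    ∀ g g', deltaMap S g g' = MulAut.conj (ω g g')

/-- `S ∈ C¹_s(G, Aut(N))` with `δ_S = C_N ∘ ω` for some `ω ∈ C²_ss(G, N)`. -/
structure IsStronglySmoothOuterAction (S : G → MulAut N) : Prop where
  isC1Aut : IsC1Aut 𝕜 E F S
  exists_lift : ∃ ω : G → G → N, IsC2ss 𝕜 E F ω ∧
    ∀ g g', deltaMap S g g' = MulAut.conj (ω g g')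

/-- `S ∼ S'`, i.e. `S' = (C_N ∘ h) · S` for some `h ∈ C¹_s(G, N)`. -/
def OuterEquiv (S S' : G → MulAut N) : Prop :=
  ∃ h : G → N, IsC1 𝕜 E F h ∧ ∀ g, S' g = MulAut.conj (h g) * S g

end LocallySmoothCochains

section Cohomology

open scoped IsMulCommutative

/-- The differential `d_S` on `Z(N)`-valued 2-cochains, for `G` acting on `Z(N)` through `S`. -/
def d₂ {G N : Type*} [Group G] [Group N] (S : G → MulAut N) :
    (G → G → Subgroup.center N) →* (G → G → G → Subgroup.center N) where
  toFun f g₀ g₁ g₂ := Subgroup.centerCongr (S g₀) (f g₁ g₂) * (f (g₀ * g₁) g₂)⁻¹ *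
    f g₀ (g₁ * g₂) * (f g₀ g₁)⁻¹
  map_one' := by funext; simp
  map_mul' f f' := by
    funext g₀ g₁ g₂
    simp only [Pi.mul_apply, map_mul, mul_inv]
    ac_rfl

/-- The differential `d_S` on `Z(N)`-valued 3-cochains. -/
def d₃ {G N : Type*} [Group G] [Group N] (S : G → MulAut N) :
    (G → G → G → Subgroup.center N) →* (G → G → G → G → Subgroup.center N) where
  toFun f g₀ g₁ g₂ g₃ := Subgroup.centerCongr (S g₀) (f g₁ g₂ g₃) * (f (g₀ * g₁) g₂ g₃)⁻¹ *
    f g₀ (g₁ * g₂) g₃ * (f g₀ g₁ (g₂ * g₃))⁻¹ * f g₀ g₁ g₂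
  map_one' := by funext; simp
  map_mul' f f' := by
    funext g₀ g₁ g₂ g₃
    simp only [Pi.mul_apply, map_mul, mul_inv]
    ac_rfl

/-- If `δ_S = C_N ∘ ω`, then `d_S ω` takes values in `Z(N)`. -/
def dCentral {G N : Type*} [Group G] [Group N] {S : G → MulAut N} {ω : G → G → N}
    (h : ∀ g g', deltaMap S g g' = MulAut.conj (ω g g')) (g g' g'' : G) : Subgroup.center N :=
  ⟨dCochain S ω g g' g'', dCochain_mem_center h g g' g''⟩

theorem d₃_dCentral {G N : Type*} [Group G] [Group N] {S : G → MulAut N} {ω : G → G → N}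
    (h : ∀ g g', deltaMap S g g' = MulAut.conj (ω g g')) : d₃ S (dCentral h) = 1 := by
  funext a b c d
  have h1 : Subgroup.centerCongr (S a) (dCentral h b c d) * dCentral h a (b * c) d *
      dCentral h a b c = dCentral h a b (c * d) * dCentral h (a * b) c d :=
    Subtype.ext (dCochain_cocycle h a b c d)
  change Subgroup.centerCongr (S a) (dCentral h b c d) * (dCentral h (a * b) c d)⁻¹ *
    dCentral h a (b * c) d * (dCentral h a b (c * d))⁻¹ * dCentral h a b c = 1
  have h2 : Subgroup.centerCongr (S a) (dCentral h b c d) * (dCentral h (a * b) c d)⁻¹ *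
    dCentral h a (b * c) d * (dCentral h a b (c * d))⁻¹ * dCentral h a b c =
    (Subgroup.centerCongr (S a) (dCentral h b c d) * dCentral h a (b * c) d * dCentral h a b c) *
      (dCentral h a b (c * d) * dCentral h (a * b) c d)⁻¹ := by
    rw [mul_inv]; ac_rfl
  rw [h2, h1, mul_inv_cancel]

theorem coe_d₂ {G N : Type*} [Group G] [Group N] (S : G → MulAut N)
    (f : G → G → Subgroup.center N) (a b c : G) :
    (d₂ S f a b c : N) = dCochain S (fun x y => (f x y : N)) a b c := by
  have h : d₂ S f a b c = Subgroup.centerCongr (S a) (f b c) * f a (b * c) *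
      (f (a * b) c)⁻¹ * (f a b)⁻¹ := by
    change Subgroup.centerCongr (S a) (f b c) * (f (a * b) c)⁻¹ *
      f a (b * c) * (f a b)⁻¹ = _
    ac_rfl
  rw [h]
  rfl

variable (𝕜 : Type*) [RCLike 𝕜]
  (E : Type*) [AddCommGroup E] [Module 𝕜 E] [TopologicalSpace E] [IsTopologicalAddGroup E]
  [ContinuousSMul 𝕜 E]
  (F : Type*) [AddCommGroup F] [Module 𝕜 F] [TopologicalSpace F] [IsTopologicalAddGroup F]
  [ContinuousSMul 𝕜 F] [PolynormableSpace 𝕜 F] [T2Space F]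
  {G : Type*} [Group G] [TopologicalSpace G] [ChartedSpace E G]
  {N : Type*} [Group N] [TopologicalSpace N] [ChartedSpace F N] [IsLieGroup 𝕜 F N]

variable (G N) in
/-- The group `C²_s(G, Z(N))`; smoothness is that of `N`-valued maps. -/
def C₂Center : Subgroup (G → G → Subgroup.center N) where
  carrier := {f | IsC2 𝕜 E F fun g g' => (f g g' : N)}
  one_mem' := ⟨fun _ => rfl, fun _ => rfl, (mSmoothOn_const 1 _).locallySmooth⟩
  mul_mem' {f f'} hf hf' := ⟨fun g => by simp [hf.one_left, hf'.one_left],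
    fun g => by simp [hf.one_right, hf'.one_right], hf.locallySmooth.mul hf'.locallySmooth⟩
  inv_mem' {f} hf := ⟨fun g => by simp [hf.one_left],
    fun g => by simp [hf.one_right], hf.locallySmooth.inv⟩

variable (G N) in
/-- The group `C²_ss(G, Z(N))`. -/
def C₂ssCenter : Subgroup (G → G → Subgroup.center N) where
  carrier := {f | IsC2ss 𝕜 E F fun g g' => (f g g' : N)}
  one_mem' := ⟨(C₂Center 𝕜 E F G N).one_mem, fun g => by
    simpa using (mSmoothOn_const (1 : N) _).locallySmooth⟩
  mul_mem' {f f'} hf hf' := ⟨(C₂Center 𝕜 E F G N).mul_mem hf.toIsC2 hf'.toIsC2, fun g => by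
    convert (hf.locallySmooth_twist g).mul (hf'.locallySmooth_twist g) using 2 with x
    have : (f * f') g x * ((f * f') (g * x * g⁻¹) g)⁻¹ = (f g x * (f (g * x * g⁻¹) g)⁻¹) *
        (f' g x * (f' (g * x * g⁻¹) g)⁻¹) := by
      simp only [Pi.mul_apply, mul_inv]
      ac_rfl
    exact congrArg Subtype.val this⟩
  inv_mem' {f} hf := ⟨(C₂Center 𝕜 E F G N).inv_mem hf.toIsC2, fun g => by
    convert (hf.locallySmooth_twist g).inv using 2 with x
    have : f⁻¹ g x * (f⁻¹ (g * x * g⁻¹) g)⁻¹ = (f g x * (f (g * x * g⁻¹) g)⁻¹)⁻¹ := by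
      simp only [Pi.inv_apply, mul_inv]
    exact congrArg Subtype.val this⟩

variable (G N) in
/-- The group `C³_s(G, Z(N))`. -/
def C₃Center : Subgroup (G → G → G → Subgroup.center N) where
  carrier := {f | IsC3 𝕜 E F fun g g' g'' => (f g g' g'' : N)}
  one_mem' := ⟨fun _ _ => rfl, fun _ _ => rfl, fun _ _ => rfl,
    (mSmoothOn_const 1 _).locallySmooth⟩
  mul_mem' {f f'} hf hf' := ⟨fun g g' => by simp [hf.one_left, hf'.one_left],
    fun g g' => by simp [hf.one_mid, hf'.one_mid],
    fun g g' => by simp [hf.one_right, hf'.one_right], hf.locallySmooth.mul hf'.locallySmooth⟩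
  inv_mem' {f} hf := ⟨fun g g' => by simp [hf.one_left],
    fun g g' => by simp [hf.one_mid], fun g g' => by simp [hf.one_right], hf.locallySmooth.inv⟩

/-- The group of cocycles `Z³_s(G, Z(N))_S`. -/
def Z₃ (S : G → MulAut N) : Subgroup (G → G → G → Subgroup.center N) :=
  C₃Center 𝕜 E F G N ⊓ (d₃ S).ker

/-- `H³_s(G, Z(N))_S = Z³_s(G, Z(N))_S / d_S(C²_s(G, Z(N)))`. The coboundaries form a subgroup of
`Z³_s(G, Z(N))_S` when `S` is a smooth outer action: see `map_C₂Center_le_Z₃`. -/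
abbrev H₃s (S : G → MulAut N) : Type _ :=
  Z₃ 𝕜 E F S ⧸ ((C₂Center 𝕜 E F G N).map (d₂ S)).subgroupOf (Z₃ 𝕜 E F S)

/-- `H³_ss(G, Z(N))_S = Z³_s(G, Z(N))_S / d_S(C²_ss(G, Z(N)))`. -/
abbrev H₃ss (S : G → MulAut N) : Type _ :=
  Z₃ 𝕜 E F S ⧸ ((C₂ssCenter 𝕜 E F G N).map (d₂ S)).subgroupOf (Z₃ 𝕜 E F S)

instance (S : G → MulAut N) : CommGroup (H₃s 𝕜 E F S) :=
  QuotientGroup.Quotient.commGroup _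

variable {𝕜 E F}

theorem dCentral_mem_Z₃ [IsLieGroup 𝕜 E G] [PolynormableSpace 𝕜 E] [T2Space E]
    {S : G → MulAut N} (hS : IsC1Aut 𝕜 E F S) {ω : G → G → N}
    (hω : IsC2 𝕜 E F ω) (h : ∀ g g', deltaMap S g g' = MulAut.conj (ω g g')) :
    dCentral h ∈ Z₃ 𝕜 E F S := by
  refine ⟨⟨fun g g' => ?_, fun g g' => ?_, fun g g' => ?_, ?_⟩, d₃_dCentral h⟩
  · simp [dCentral, dCochain, hS.map_one, hω.one_left]
  · simp [dCentral, dCochain, hω.one_left, hω.one_right]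
  · simp [dCentral, dCochain, hω.one_right]
  · have hmul := (IsLieGroup.smooth_mul (𝕜 := 𝕜) (E := E) (G := G)).locallySmooth
    have e1 : LocallySmooth 𝕜 (E × E × E) E (fun p : G × G × G => p.1) :=
      (mSmoothOn_fst univ).locallySmooth
    have e23 : LocallySmooth 𝕜 (E × E × E) (E × E) (fun p : G × G × G => p.2) :=
      (mSmoothOn_snd univ).locallySmooth
    have e2 : LocallySmooth 𝕜 (E × E × E) E (fun p : G × G × G => p.2.1) :=
      (mSmoothOn_fst (𝕜 := 𝕜) (E := E) (M := G) (E' := E) (M' := G) univ).locallySmooth.comp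
        e23 rfl
    have e3 : LocallySmooth 𝕜 (E × E × E) E (fun p : G × G × G => p.2.2) :=
      (mSmoothOn_snd (𝕜 := 𝕜) (E := E) (M := G) (E' := E) (M' := G) univ).locallySmooth.comp
        e23 rfl
    have hSl : LocallySmooth 𝕜 (E × F) F (fun p : G × N => S p.1 p.2) := by
      obtain ⟨U, hU, h1, hs⟩ := hS.smooth_near_one
      exact ⟨_, hU.prod isOpen_univ, ⟨h1, mem_univ _⟩, hs⟩
    have t1 : LocallySmooth 𝕜 (E × E × E) F (fun p : G × G × G => S p.1 (ω p.2.1 p.2.2)) :=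
      hSl.comp (e1.prodMk (hω.locallySmooth.comp e23 rfl))
        (Prod.ext rfl (hω.one_left _))
    have t2 : LocallySmooth 𝕜 (E × E × E) F (fun p : G × G × G => ω p.1 (p.2.1 * p.2.2)) :=
      hω.locallySmooth.comp (e1.prodMk (hmul.comp e23 rfl)) (Prod.ext rfl (mul_one _))
    have t3 : LocallySmooth 𝕜 (E × E × E) F (fun p : G × G × G => ω (p.1 * p.2.1) p.2.2) :=
      hω.locallySmooth.comp ((hmul.comp (e1.prodMk e2) rfl).prodMk e3)
        (Prod.ext (mul_one _) rfl)
    have t4 : LocallySmooth 𝕜 (E × E × E) F (fun p : G × G × G => ω p.1 p.2.1) :=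
      hω.locallySmooth.comp (e1.prodMk e2) rfl
    exact ((t1.mul t2).mul t3.inv).mul t4.inv

theorem exists_central_of_lifts {S : G → MulAut N} {ω ω' : G → G → N}
    (h : ∀ g g', deltaMap S g g' = MulAut.conj (ω g g'))
    (h' : ∀ g g', deltaMap S g g' = MulAut.conj (ω' g g')) :
    ∃ β : G → G → Subgroup.center N, ∀ g g', ω' g g' = ω g g' * β g g' := by
  refine ⟨fun g g' => ⟨(ω g g')⁻¹ * ω' g g', ?_⟩, fun g g' => by simp⟩
  rw [Subgroup.mem_center_iff]
  intro n
  have := DFunLike.congr_fun ((h g g').symm.trans (h' g g')) n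
  simp only [MulAut.conj_apply] at this
  calc n * ((ω g g')⁻¹ * ω' g g')
      = (ω g g')⁻¹ * (ω g g' * n * (ω g g')⁻¹) * ω' g g' := by group
    _ = (ω g g')⁻¹ * ω' g g' * n := by rw [this]; group

theorem central_mem_C₂ {ω ω' : G → G → N} {β : G → G → Subgroup.center N}
    (hβ : ∀ g g', ω' g g' = ω g g' * β g g') (hω : IsC2 𝕜 E F ω) (hω' : IsC2 𝕜 E F ω') :
    β ∈ C₂Center 𝕜 E F G N := by
  have hb : ∀ g g', (β g g' : N) = (ω g g')⁻¹ * ω' g g' := fun g g' => by rw [hβ]; group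
  refine ⟨fun g => ?_, fun g => ?_, ?_⟩
  · simp [hb, hω.one_left, hω'.one_left]
  · simp [hb, hω.one_right, hω'.one_right]
  · simp only [hb]
    exact hω.locallySmooth.inv.mul hω'.locallySmooth

theorem central_mem_C₂ss {ω ω' : G → G → N} {β : G → G → Subgroup.center N}
    (hβ : ∀ g g', ω' g g' = ω g g' * β g g') (hω : IsC2ss 𝕜 E F ω) (hω' : IsC2ss 𝕜 E F ω') :
    β ∈ C₂ssCenter 𝕜 E F G N := by
  refine ⟨central_mem_C₂ hβ hω.toIsC2 hω'.toIsC2, fun g => ?_⟩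
  convert (hω.locallySmooth_twist g).inv.mul (hω'.locallySmooth_twist g) using 2 with x
  have hc : ∀ n : N, (n * β (g * x * g⁻¹) g : N) = β (g * x * g⁻¹) g * n := fun n =>
    Subgroup.mem_center_iff.1 (β (g * x * g⁻¹) g).2 n
  have hc' : ((β g x : N) * (β (g * x * g⁻¹) g : N)⁻¹) * (ω (g * x * g⁻¹) g)⁻¹ =
      (ω (g * x * g⁻¹) g)⁻¹ * ((β g x : N) * (β (g * x * g⁻¹) g : N)⁻¹) :=
    (Subgroup.mem_center_iff.1 (β g x * (β (g * x * g⁻¹) g)⁻¹).2 _).symm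
  have e : ω' g x * (ω' (g * x * g⁻¹) g)⁻¹ =
      ω g x * (ω (g * x * g⁻¹) g)⁻¹ * ((β g x : N) * (β (g * x * g⁻¹) g : N)⁻¹) := by
    rw [mul_assoc (ω g x), ← hc', hβ, hβ]
    group
  rw [e, inv_mul_cancel_left]

theorem dCentral_mul {S : G → MulAut N} {ω ω' : G → G → N} {β : G → G → Subgroup.center N}
    (hβ : ∀ g g', ω' g g' = ω g g' * β g g')
    (h : ∀ g g', deltaMap S g g' = MulAut.conj (ω g g'))
    (h' : ∀ g g', deltaMap S g g' = MulAut.conj (ω' g g')) :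
    dCentral h' = dCentral h * d₂ S β := by
  obtain rfl : ω' = fun g g' => ω g g' * β g g' := by funext g g'; exact hβ g g'
  funext a b c
  refine Subtype.ext ((dCochain_mul_central (fun x y => (β x y).2) a b c).trans ?_)
  rw [← coe_d₂]
  rfl

variable [IsLieGroup 𝕜 E G] [PolynormableSpace 𝕜 E] [T2Space E]

theorem map_C₂Center_le_Z₃ {S : G → MulAut N} (hS : IsSmoothOuterAction 𝕜 E F S) :
    (C₂Center 𝕜 E F G N).map (d₂ S) ≤ Z₃ 𝕜 E F S := by
  rintro _ ⟨β, hβ, rfl⟩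
  obtain ⟨ω, hω, h⟩ := hS.exists_lift
  have hω' : IsC2 𝕜 E F fun g g' => ω g g' * β g g' :=
    ⟨fun g => by simpa [hω.one_left] using hβ.one_left g,
      fun g => by simpa [hω.one_right] using hβ.one_right g,
      hω.locallySmooth.mul hβ.locallySmooth⟩
  have h' : ∀ g g', deltaMap S g g' = MulAut.conj (ω g g' * β g g') := fun g g' => by
    rw [h, map_mul]
    ext n
    simp [(Subgroup.mem_center_iff.1 (β g g').2 n).symm]
  have := dCentral_mul (fun _ _ => rfl) h h'
  rw [← inv_mul_eq_iff_eq_mul] at this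
  rw [← this]
  exact mul_mem (inv_mem (dCentral_mem_Z₃ hS.isC1Aut hω h)) (dCentral_mem_Z₃ hS.isC1Aut hω' h')

/-- The class `[d_S ω] ∈ H³_s(G, Z(N))_S`. -/
def charClassSOf {S : G → MulAut N} (hS : IsC1Aut 𝕜 E F S) {ω : G → G → N}
    (hω : IsC2 𝕜 E F ω) (h : ∀ g g', deltaMap S g g' = MulAut.conj (ω g g')) : H₃s 𝕜 E F S :=
  QuotientGroup.mk ⟨dCentral h, dCentral_mem_Z₃ hS hω h⟩

/-- The class `[d_S ω] ∈ H³_ss(G, Z(N))_S`. -/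
def charClassSsOf {S : G → MulAut N} (hS : IsC1Aut 𝕜 E F S) {ω : G → G → N}
    (hω : IsC2ss 𝕜 E F ω) (h : ∀ g g', deltaMap S g g' = MulAut.conj (ω g g')) : H₃ss 𝕜 E F S :=
  QuotientGroup.mk ⟨dCentral h, dCentral_mem_Z₃ hS hω.toIsC2 h⟩

/-- The class `[d_S ω]` does not depend on `ω`. -/
theorem charClassSOf_eq {S : G → MulAut N} (hS : IsC1Aut 𝕜 E F S) {ω ω' : G → G → N}
    (hω : IsC2 𝕜 E F ω) (h : ∀ g g', deltaMap S g g' = MulAut.conj (ω g g'))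
    (hω' : IsC2 𝕜 E F ω') (h' : ∀ g g', deltaMap S g g' = MulAut.conj (ω' g g')) :
    charClassSOf hS hω h = charClassSOf hS hω' h' := by
  obtain ⟨β, hβ⟩ := exists_central_of_lifts h h'
  refine QuotientGroup.eq.2 ⟨β, central_mem_C₂ hβ hω hω', ?_⟩
  exact (inv_mul_eq_iff_eq_mul.2 (dCentral_mul hβ h h')).symm

/-- The class `[d_S ω]` does not depend on `ω`. -/
theorem charClassSsOf_eq {S : G → MulAut N} (hS : IsC1Aut 𝕜 E F S) {ω ω' : G → G → N}
    (hω : IsC2ss 𝕜 E F ω) (h : ∀ g g', deltaMap S g g' = MulAut.conj (ω g g'))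
    (hω' : IsC2ss 𝕜 E F ω') (h' : ∀ g g', deltaMap S g g' = MulAut.conj (ω' g g')) :
    charClassSsOf hS hω h = charClassSsOf hS hω' h' := by
  obtain ⟨β, hβ⟩ := exists_central_of_lifts h h'
  refine QuotientGroup.eq.2 ⟨β, central_mem_C₂ss hβ hω hω', ?_⟩
  exact (inv_mul_eq_iff_eq_mul.2 (dCentral_mul hβ h h')).symm

/-- The characteristic class `χ_s(S) = [d_S ω]`, for any `ω ∈ C²_s(G, N)` with `δ_S = C_N ∘ ω`. -/
noncomputable def charClassS {S : G → MulAut N} (hS : IsSmoothOuterAction 𝕜 E F S) :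
    H₃s 𝕜 E F S :=
  charClassSOf hS.isC1Aut hS.exists_lift.choose_spec.1 hS.exists_lift.choose_spec.2

/-- The characteristic class `χ_ss(S) = [d_S ω]`, for any `ω ∈ C²_ss(G, N)` with `δ_S = C_N ∘ ω`. -/
noncomputable def charClassSs {S : G → MulAut N} (hS : IsStronglySmoothOuterAction 𝕜 E F S) :
    H₃ss 𝕜 E F S :=
  charClassSsOf hS.isC1Aut hS.exists_lift.choose_spec.1 hS.exists_lift.choose_spec.2

end Cohomology

section Extensions

universe uE uF uG uN

/-- A Lie group extension `1 → N → Total → G → 1`: a short exact sequence of Lie group morphisms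
for which `q : Total → G` is a smooth (locally trivial) principal bundle for the right action of
`N` through `ι`: over each small `U`, the map `Φ : U × N → q⁻¹(U)` is an `N`-equivariant
diffeomorphism over `U` with inverse `x ↦ (q x, Ψ x)`. -/
structure LieGroupExtension (𝕜 : Type*) [RCLike 𝕜]
    (E : Type uE) [AddCommGroup E] [Module 𝕜 E] [TopologicalSpace E]
    (F : Type uF) [AddCommGroup F] [Module 𝕜 F] [TopologicalSpace F]
    (G : Type uG) [Group G] [TopologicalSpace G] [ChartedSpace E G]
    (N : Type uN) [Group N] [TopologicalSpace N] [ChartedSpace F N] where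
  Model : Type (max uE uF)
  [addCommGroup : AddCommGroup Model]
  [module : Module 𝕜 Model]
  [topologicalSpaceModel : TopologicalSpace Model]
  [isTopologicalAddGroup : IsTopologicalAddGroup Model]
  [continuousSMul : ContinuousSMul 𝕜 Model]
  [polynormableSpace : PolynormableSpace 𝕜 Model]
  [t2Space : T2Space Model]
  Total : Type (max uG uN)
  [group : Group Total]
  [topologicalSpace : TopologicalSpace Total]
  [chartedSpace : ChartedSpace Model Total]
  [isLieGroup : IsLieGroup 𝕜 Model Total]
  ι : N →* Total
  q : Total →* G
  ι_injective : Function.Injective ι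
  range_ι : ι.range = q.ker
  q_surjective : Function.Surjective q
  ι_smooth : MSmoothOn 𝕜 F Model ι univ
  q_smooth : MSmoothOn 𝕜 Model E q univ
  locallyTrivial : ∀ g₀ : G, ∃ U : Set G, IsOpen U ∧ g₀ ∈ U ∧
    ∃ (Φ : G × N → Total) (Ψ : Total → N),
      MSmoothOn 𝕜 (E × F) Model Φ (U ×ˢ univ) ∧ MSmoothOn 𝕜 Model F Ψ (q ⁻¹' U) ∧
      (∀ g ∈ U, ∀ n, q (Φ (g, n)) = g ∧ Ψ (Φ (g, n)) = n) ∧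
      (∀ x, q x ∈ U → Φ (q x, Ψ x) = x) ∧
      ∀ g ∈ U, ∀ n n', Φ (g, n * n') = Φ (g, n) * ι n'

attribute [instance] LieGroupExtension.addCommGroup LieGroupExtension.module
  LieGroupExtension.topologicalSpaceModel LieGroupExtension.isTopologicalAddGroup
  LieGroupExtension.continuousSMul LieGroupExtension.polynormableSpace LieGroupExtension.t2Space
  LieGroupExtension.group LieGroupExtension.topologicalSpace LieGroupExtension.chartedSpace
  LieGroupExtension.isLieGroup

variable (𝕜 : Type*) [RCLike 𝕜]
  (E : Type uE) [AddCommGroup E] [Module 𝕜 E] [TopologicalSpace E]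
  (F : Type uF) [AddCommGroup F] [Module 𝕜 F] [TopologicalSpace F]
  (G : Type uG) [Group G] [TopologicalSpace G] [ChartedSpace E G]
  (N : Type uN) [Group N] [TopologicalSpace N] [ChartedSpace F N]

variable {𝕜 E F G N} in
/-- Equivalence of extensions: a Lie group morphism inducing the identity on `N` and on `G`. -/
def LieGroupExtension.Equivalent (X Y : LieGroupExtension 𝕜 E F G N) : Prop :=
  ∃ φ : X.Total →* Y.Total, MSmoothOn 𝕜 X.Model Y.Model φ univ ∧
    (∀ n, φ (X.ι n) = Y.ι n) ∧ ∀ x, Y.q (φ x) = X.q x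

/-- `Ext(G, N)`: the equivalence classes of Lie group extensions of `G` by `N`. -/
def LieExt : Type _ :=
  Quot (LieGroupExtension.Equivalent (𝕜 := 𝕜) (E := E) (F := F) (G := G) (N := N))

variable {𝕜 E F G N}

/-- `σ` is a normalized section of `q` that is smooth in an identity neighbourhood. -/
structure LieGroupExtension.IsSection (X : LieGroupExtension 𝕜 E F G N) (σ : G → X.Total) :
    Prop where
  isC1 : IsC1 𝕜 E X.Model σ
  q_apply : ∀ g, X.q (σ g) = g

/-- The extension corresponds to the kernel `[S]`: for a normalized locally smooth section `σ`, the
map `S'(g)(n) = σ(g) n σ(g)⁻¹` satisfies `[S'] = [S]`. -/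
def LieGroupExtension.CorrespondsTo (X : LieGroupExtension 𝕜 E F G N) (S : G → MulAut N) : Prop :=
  ∃ (σ : G → X.Total) (S' : G → MulAut N), X.IsSection σ ∧
    (∀ g n, X.ι (S' g n) = σ g * X.ι n * (σ g)⁻¹) ∧ OuterEquiv 𝕜 E F S S'

variable (𝕜 E F) in
/-- `Ext(G, N)_[S]`: the classes of extensions of `G` by `N` corresponding to `[S]`. -/
def ExtKernel (S : G → MulAut N) : Set (LieExt 𝕜 E F G N) :=
  {c | ∃ X : LieGroupExtension 𝕜 E F G N, Quot.mk _ X = c ∧ X.CorrespondsTo S}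

end Extensions

/-!
Changing `ω` by a central cochain `β` changes `d_S ω` by `d_S β`, so the characteristic class of `S`
is trivial if and only if `ω` can be chosen to be a factor set, i.e. with `d_S ω = 1`. A normalized
locally smooth section of an extension corresponding to `[S]` yields, after multiplication by a map
to `N`, such a factor set, and it lies in `C²_ss` because conjugation by a fixed element is smooth.

Conversely, a factor set turns `N × G` into a group, the crossed product. The coordinates
`N × G` are used over an identity neighbourhood of `G` and carried around by left translations.
This gives a manifold with smooth left translations on which multiplication and inversion are smooth
near the identity, and right translations are smooth as soon as every inner automorphism is smooth
near the identity. For elements of `N` this always holds, and for the elements of the canonical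
section it is the condition `ω ∈ C²_ss`. If `G` is connected, the condition is automatic: the
elements whose conjugation is smooth near the identity form a subgroup that contains `N` and an
identity neighbourhood, hence everything.
-/

section LocalSmoothness

variable {𝕜 : Type*} [RCLike 𝕜]
  {E : Type*} [AddCommGroup E] [Module 𝕜 E] [TopologicalSpace E]
  {E' : Type*} [AddCommGroup E'] [Module 𝕜 E'] [TopologicalSpace E']
  {E'' : Type*} [AddCommGroup E''] [Module 𝕜 E''] [TopologicalSpace E'']
  {M : Type*} [TopologicalSpace M] [ChartedSpace E M]
  {M' : Type*} [TopologicalSpace M'] [ChartedSpace E' M']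
  {M'' : Type*} [TopologicalSpace M''] [ChartedSpace E'' M'']

theorem MSmoothOn.continuous {f : M → M'} (hf : MSmoothOn 𝕜 E E' f univ) : Continuous f :=
  continuousOn_univ.1 hf.1

theorem locallySmooth_id [One M] [IsSmoothManifold 𝕜 E M] :
    LocallySmooth 𝕜 E E (fun x : M => x) :=
  (mSmoothOn_id univ).locallySmooth

theorem locallySmooth_const [One M] (c : M') : LocallySmooth 𝕜 E E' (fun _ : M => c) :=
  (mSmoothOn_const c univ).locallySmooth

theorem locallySmooth_fst [One M] [One M'] [IsSmoothManifold 𝕜 E M] :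
    LocallySmooth 𝕜 (E × E') E (Prod.fst : M × M' → M) :=
  (mSmoothOn_fst univ).locallySmooth

theorem locallySmooth_snd [One M] [One M'] [IsSmoothManifold 𝕜 E' M'] :
    LocallySmooth 𝕜 (E × E') E' (Prod.snd : M × M' → M') :=
  (mSmoothOn_snd univ).locallySmooth

variable [IsTopologicalAddGroup E] [ContinuousSMul 𝕜 E]

theorem MSmoothOn.of_local [T2Space E'] {f : M → M'} {W : Set M}
    (h : ∀ x ∈ W, ∃ O, IsOpen O ∧ x ∈ O ∧ MSmoothOn 𝕜 E E' f O) : MSmoothOn 𝕜 E E' f W := by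
  refine ⟨fun x hx => ?_, fun e he e' he' n => IsCk.of_local ?_⟩
  · obtain ⟨O, hO, hxO, hf⟩ := h x hx
    exact (hf.1.continuousAt (hO.mem_nhds hxO)).continuousWithinAt
  · rintro v ⟨hv, hvW, hv'⟩
    obtain ⟨O, hO, hxO, hf⟩ := h _ hvW
    exact ⟨e.target ∩ e.symm ⁻¹' (O ∩ f ⁻¹' e'.source),
      e.symm.isOpen_inter_preimage (hf.1.isOpen_inter_preimage hO e'.open_source),
      ⟨hv, hxO, hv'⟩, hf.2 e he e' he' n⟩

variable [IsTopologicalAddGroup E'] [ContinuousSMul 𝕜 E'] [PolynormableSpace 𝕜 E''] [T2Space E'']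

theorem MSmoothOn.comp_preimage {f : M → M'} {g : M' → M''} {W : Set M'}
    (hg : MSmoothOn 𝕜 E' E'' g W) (hf : MSmoothOn 𝕜 E E' f univ) (hW : IsOpen W) :
    MSmoothOn 𝕜 E E'' (g ∘ f) (f ⁻¹' W) :=
  hg.comp (hf.mono (subset_univ _)) (hW.preimage hf.continuous) hW fun _ hx => hx

theorem MSmoothOn.of_locallySmooth_comp [One M'] {f : M → M''}
    (h : ∀ x, ∃ (φ : M → M') (k : M' → M''), MSmoothOn 𝕜 E E' φ univ ∧ φ x = 1 ∧
      LocallySmooth 𝕜 E' E'' k ∧ ∀ y, k (φ y) = f y) : MSmoothOn 𝕜 E E'' f univ := by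
  refine MSmoothOn.of_local fun x _ => ?_
  obtain ⟨φ, k, hφ, hx, ⟨O, hO, h1, hk⟩, hkφ⟩ := h x
  refine ⟨φ ⁻¹' O, hO.preimage hφ.continuous, by rwa [mem_preimage, hx], ?_⟩
  rw [← funext hkφ]
  exact hk.comp_preimage hφ hO

end LocalSmoothness

section LieGroupCalculus

variable {𝕜 : Type*} [RCLike 𝕜]
  {E : Type*} [AddCommGroup E] [Module 𝕜 E] [TopologicalSpace E]
  {F : Type*} [AddCommGroup F] [Module 𝕜 F] [TopologicalSpace F]
  {M : Type*} [TopologicalSpace M] [ChartedSpace E M]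
  {N : Type*} [Group N] [TopologicalSpace N] [ChartedSpace F N]

variable (𝕜 F N) in
theorem IsLieGroup.isTopologicalGroup [h : IsLieGroup 𝕜 F N] : IsTopologicalGroup N where
  continuous_mul := h.smooth_mul.continuous
  continuous_inv := h.smooth_inv.continuous

variable [IsLieGroup 𝕜 F N] [IsTopologicalAddGroup E] [ContinuousSMul 𝕜 E] [IsTopologicalAddGroup F]
  [ContinuousSMul 𝕜 F] [PolynormableSpace 𝕜 F] [T2Space F]

theorem MSmoothOn.mul {f g : M → N} {W : Set M} (hf : MSmoothOn 𝕜 E F f W)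
    (hg : MSmoothOn 𝕜 E F g W) (hW : IsOpen W) : MSmoothOn 𝕜 E F (fun x => f x * g x) W :=
  IsLieGroup.smooth_mul.comp (hf.prodMk hg) hW isOpen_univ (mapsTo_univ _ _)

theorem MSmoothOn.inv {f : M → N} {W : Set M} (hf : MSmoothOn 𝕜 E F f W) (hW : IsOpen W) :
    MSmoothOn 𝕜 E F (fun x => (f x)⁻¹) W :=
  IsLieGroup.smooth_inv.comp hf hW isOpen_univ (mapsTo_univ _ _)

theorem IsLieGroup.mSmoothOn_mul_left (a : N) : MSmoothOn 𝕜 F F (fun x => a * x) univ :=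
  (mSmoothOn_const a univ).mul (mSmoothOn_id univ) isOpen_univ

end LieGroupCalculus

section LocallyLieGroups

/-- A group and smooth manifold whose left translations are smooth and whose multiplication and
inversion are smooth near the identity. This is a Lie group except that right translations need not
be smooth. -/
class IsLocallyLieGroup (𝕜 : Type*) [RCLike 𝕜] (E : Type*) [AddCommGroup E] [Module 𝕜 E]
    [TopologicalSpace E] (Q : Type*) [Group Q] [TopologicalSpace Q] [ChartedSpace E Q] : Prop
    extends IsSmoothManifold 𝕜 E Q where
  mSmoothOn_mul_left : ∀ a : Q, MSmoothOn 𝕜 E E (fun x => a * x) univ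
  locallySmooth_mul : LocallySmooth 𝕜 (E × E) E (fun p : Q × Q => p.1 * p.2)
  locallySmooth_inv : LocallySmooth 𝕜 E E (fun x : Q => x⁻¹)

variable {𝕜 : Type*} [RCLike 𝕜]
  {E : Type*} [AddCommGroup E] [Module 𝕜 E] [TopologicalSpace E] [IsTopologicalAddGroup E]
  [ContinuousSMul 𝕜 E] [PolynormableSpace 𝕜 E] [T2Space E]
  {Q : Type*} [Group Q] [TopologicalSpace Q] [ChartedSpace E Q]

instance [IsLieGroup 𝕜 E Q] : IsLocallyLieGroup 𝕜 E Q where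
  mSmoothOn_mul_left := IsLieGroup.mSmoothOn_mul_left
  locallySmooth_mul := IsLieGroup.smooth_mul.locallySmooth
  locallySmooth_inv := IsLieGroup.smooth_inv.locallySmooth

section Products

variable {E' : Type*} [AddCommGroup E'] [Module 𝕜 E'] [TopologicalSpace E']
  [IsTopologicalAddGroup E'] [ContinuousSMul 𝕜 E']
  {M : Type*} [One M] [TopologicalSpace M] [ChartedSpace E' M] [IsLocallyLieGroup 𝕜 E Q]

theorem LocallySmooth.mul_of_map_one {f g : M → Q} (hf : LocallySmooth 𝕜 E' E f)
    (hg : LocallySmooth 𝕜 E' E g) (hf1 : f 1 = 1) (hg1 : g 1 = 1) :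
    LocallySmooth 𝕜 E' E (fun x => f x * g x) :=
  IsLocallyLieGroup.locallySmooth_mul.comp (hf.prodMk hg) (Prod.ext hf1 hg1)

theorem LocallySmooth.inv_of_map_one {f : M → Q} (hf : LocallySmooth 𝕜 E' E f) (hf1 : f 1 = 1) :
    LocallySmooth 𝕜 E' E (fun x => (f x)⁻¹) :=
  IsLocallyLieGroup.locallySmooth_inv.comp hf hf1

theorem LocallySmooth.mul_left {f : M → Q} (hf : LocallySmooth 𝕜 E' E f) (a : Q) :
    LocallySmooth 𝕜 E' E (fun x => a * f x) :=
  (IsLocallyLieGroup.mSmoothOn_mul_left a).locallySmooth_comp hf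

theorem IsLocallyLieGroup.mSmoothOn_monoidHom {H : Type*} [Group H] [TopologicalSpace H]
    [ChartedSpace E' H] [IsLocallyLieGroup 𝕜 E' H] (φ : H →* Q) (hφ : LocallySmooth 𝕜 E' E φ) :
    MSmoothOn 𝕜 E' E φ univ :=
  MSmoothOn.of_locallySmooth_comp fun x =>
    ⟨fun y => x⁻¹ * y, fun y => φ x * φ y, IsLocallyLieGroup.mSmoothOn_mul_left x⁻¹,
      inv_mul_cancel x, hφ.mul_left (φ x), fun y => by simp⟩

end Products

end LocallyLieGroups

section Conjugations

variable {𝕜 : Type*} [RCLike 𝕜]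
  {E : Type*} [AddCommGroup E] [Module 𝕜 E] [TopologicalSpace E] [IsTopologicalAddGroup E]
  [ContinuousSMul 𝕜 E] [PolynormableSpace 𝕜 E] [T2Space E]
  {Q : Type*} [Group Q] [TopologicalSpace Q] [ChartedSpace E Q]

theorem locallySmooth_conj_mul {a b : Q} (ha : LocallySmooth 𝕜 E E (fun x => a * x * a⁻¹))
    (hb : LocallySmooth 𝕜 E E (fun x => b * x * b⁻¹)) :
    LocallySmooth 𝕜 E E (fun x => a * b * x * (a * b)⁻¹) := by
  simpa only [mul_inv_rev, mul_assoc] using ha.comp hb (by simp)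

variable (𝕜 E Q) in
/-- The elements `z` such that conjugation by `z` and by `z⁻¹` is smooth near the identity. -/
def smoothConj [IsSmoothManifold 𝕜 E Q] : Subgroup Q where
  carrier := {z | LocallySmooth 𝕜 E E (fun x => z * x * z⁻¹) ∧
    LocallySmooth 𝕜 E E (fun x => z⁻¹ * x * z⁻¹⁻¹)}
  one_mem' := by simpa using locallySmooth_id
  mul_mem' {a b} ha hb := ⟨locallySmooth_conj_mul ha.1 hb.1, by
    simpa only [mul_inv_rev] using locallySmooth_conj_mul hb.2 ha.2⟩
  inv_mem' {a} ha := ⟨ha.2, by simpa only [inv_inv] using ha.1⟩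

variable [IsLocallyLieGroup 𝕜 E Q]

theorem eventually_locallySmooth_conj :
    ∀ᶠ z in 𝓝 (1 : Q), LocallySmooth 𝕜 E E (fun x => z * x * z⁻¹) := by
  have hconj : LocallySmooth 𝕜 (E × E) E (fun p : Q × Q => p.1 * p.2 * p.1⁻¹) :=
    (IsLocallyLieGroup.locallySmooth_mul.mul_of_map_one
      (locallySmooth_fst.inv_of_map_one rfl) (mul_one 1) inv_one)
  obtain ⟨O, hO, h1, hsmooth⟩ := hconj
  have hslice (z : Q) : MSmoothOn 𝕜 E (E × E) (fun x : Q => (z, x)) univ :=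
    (mSmoothOn_const z univ).prodMk (mSmoothOn_id univ)
  have hO1 : {z : Q | (z, 1) ∈ O} ∈ 𝓝 (1 : Q) :=
    (hO.preimage (Continuous.prodMk_left 1)).mem_nhds h1
  filter_upwards [hO1] with z hz
  exact ⟨_, hO.preimage (hslice z).continuous, hz, hsmooth.comp_preimage (hslice z) hO⟩

theorem smoothConj_mem_nhds_one : (smoothConj 𝕜 E Q : Set Q) ∈ 𝓝 1 := by
  obtain ⟨U, hU, h1, hinv⟩ := IsLocallyLieGroup.locallySmooth_inv (𝕜 := 𝕜) (E := E) (Q := Q)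
  have hinv1 : Tendsto (fun x : Q => x⁻¹) (𝓝 1) (𝓝 1) := by
    simpa only [inv_one] using (hinv.1.continuousAt (hU.mem_nhds h1)).tendsto
  exact eventually_locallySmooth_conj.and (hinv1.eventually eventually_locallySmooth_conj)

theorem isLieGroup_of_smoothConj_eq_top (h : smoothConj 𝕜 E Q = ⊤) : IsLieGroup 𝕜 E Q where
  smooth_mul := MSmoothOn.of_locallySmooth_comp fun (a, b) => by
    have hconj := (h ▸ Subgroup.mem_top b : b ∈ smoothConj 𝕜 E Q).2
    refine ⟨fun p => (a⁻¹ * p.1, b⁻¹ * p.2), fun q => a * b * (b⁻¹ * q.1 * b⁻¹⁻¹ * q.2),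
      ((IsLocallyLieGroup.mSmoothOn_mul_left a⁻¹).comp_preimage (mSmoothOn_fst univ)
        isOpen_univ).prodMk ((IsLocallyLieGroup.mSmoothOn_mul_left b⁻¹).comp_preimage
        (mSmoothOn_snd univ) isOpen_univ), by simp, ?_, fun p => by group⟩
    exact ((hconj.comp locallySmooth_fst rfl).mul_of_map_one locallySmooth_snd
      (by simp) rfl).mul_left (a * b)
  smooth_inv := MSmoothOn.of_locallySmooth_comp fun a => by
    have hconj := (h ▸ Subgroup.mem_top a : a ∈ smoothConj 𝕜 E Q).1
    refine ⟨fun y => a⁻¹ * y, fun u => a⁻¹ * (a * u⁻¹ * a⁻¹),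
      IsLocallyLieGroup.mSmoothOn_mul_left a⁻¹, inv_mul_cancel a, ?_, fun y => by group⟩
    exact (hconj.comp IsLocallyLieGroup.locallySmooth_inv inv_one).mul_left a⁻¹

end Conjugations

theorem subgroup_eq_top_of_ker_le {G Q : Type*} [Group G] [Group Q] [TopologicalSpace G]
    [SeparatelyContinuousMul G] [ConnectedSpace G] [TopologicalSpace Q] {q : Q →* G} {σ : G → Q}
    (hσ : ContinuousAt σ 1) (hσ1 : σ 1 = 1) (hqσ : ∀ g, q (σ g) = g) {H : Subgroup Q}
    (hH : (H : Set Q) ∈ 𝓝 1) (hker : q.ker ≤ H) : H = ⊤ := by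
  have hmap : (H.map q : Set G) ∈ 𝓝 1 := by
    filter_upwards [hσ.preimage_mem_nhds (by rwa [hσ1])] with g hg
    exact ⟨σ g, hg, hqσ g⟩
  have hopen := (H.map q).isOpen_of_mem_nhds hmap
  have htop : H.map q = ⊤ := SetLike.coe_injective
    (IsClopen.eq_univ ⟨(H.map q).isClosed_of_isOpen hopen, hopen⟩ ⟨1, one_mem _⟩)
  rw [← Subgroup.comap_map_eq_self hker, htop, Subgroup.comap_top]

section LeftCoordinates

variable (𝕜 : Type*) [RCLike 𝕜]
  (E : Type*) [AddCommGroup E] [Module 𝕜 E] [TopologicalSpace E]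
  (P : Type*) [TopologicalSpace P] [ChartedSpace E P]
  (Q : Type*) [Group Q]

/-- Coordinates near the identity of a group `Q` with values in a manifold `P`, in which left
translations are smooth as long as they stay within the domain. Translating such coordinates turns
`Q` into a manifold. -/
structure LeftCoordinates extends PartialEquiv Q P where
  one_mem_source : 1 ∈ source
  isOpen_target : IsOpen target
  isOpen_translate : ∀ z, IsOpen (target ∩ {p | z * invFun p ∈ source})
  smooth_translate : ∀ z, MSmoothOn 𝕜 E E (fun p => toFun (z * invFun p))
    (target ∩ {p | z * invFun p ∈ source})

namespace LeftCoordinates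

variable {𝕜 E P Q} (D : LeftCoordinates 𝕜 E P Q)

/-- The group `Q`, made into a manifold by left translation of the coordinates `D`. -/
def Global (_ : LeftCoordinates 𝕜 E P Q) : Type _ := Q

instance : Group D.Global := inferInstanceAs (Group Q)

/-- The coordinates `D` on the type synonym `D.Global`. -/
def partialCoord : PartialEquiv D.Global P := D.toPartialEquiv

instance : TopologicalSpace D.Global :=
  ⨆ x, .coinduced (fun p : D.partialCoord.target => x * D.partialCoord.symm p)
    instTopologicalSpaceSubtype

theorem isOpen_iff {V : Set D.Global} :
    IsOpen V ↔ ∀ x, IsOpen (D.partialCoord.target ∩ {p | x * D.partialCoord.symm p ∈ V}) := by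
  have htarget : IsOpen D.partialCoord.target := D.isOpen_target
  exact isOpen_iSup_iff.trans <| forall_congr' fun x => isOpen_coinduced.trans <|
    htarget.isOpenEmbedding_subtypeVal.isOpen_iff_image_isOpen.trans <|
      iff_of_eq (congrArg IsOpen (Subtype.image_preimage_coe _
        {p | x * D.partialCoord.symm p ∈ V}))

theorem continuous_mul_left (a : D.Global) : Continuous fun x : D.Global => a * x := by
  refine ⟨fun V hV => D.isOpen_iff.2 fun x => ?_⟩
  simpa only [mem_preimage, mul_assoc] using D.isOpen_iff.1 hV (a * x)

/-- Left translation by `a` as a homeomorphism. -/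
def translate (a : D.Global) : D.Global ≃ₜ D.Global where
  toEquiv := Equiv.mulLeft a
  continuous_toFun := D.continuous_mul_left a
  continuous_invFun := D.continuous_mul_left a⁻¹

theorem isOpen_partialCoord_source : IsOpen D.partialCoord.source :=
  D.isOpen_iff.2 D.isOpen_translate

/-- The given coordinates as a partial homeomorphism on the manifold `D.Global`. -/
def coord : OpenPartialHomeomorph D.Global P where
  toPartialEquiv := D.partialCoord
  open_source := D.isOpen_partialCoord_source
  open_target := D.isOpen_target
  continuousOn_toFun := by
    refine (continuousOn_open_iff D.isOpen_partialCoord_source).2 fun V hV =>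
      D.isOpen_iff.2 fun x => ?_
    have h := (D.smooth_translate x).1.isOpen_inter_preimage (D.isOpen_translate x) hV
    rw [inter_assoc] at h
    exact h
  continuousOn_invFun := by
    refine (continuousOn_open_iff D.isOpen_target).2 fun V hV => ?_
    have h := D.isOpen_iff.1 hV 1
    simp only [one_mul] at h
    exact h

theorem mSmoothOn_coord_mul_coord_symm (z : D.Global) :
    MSmoothOn 𝕜 E E (fun p => D.coord (z * D.coord.symm p))
      (D.coord.target ∩ {p | z * D.coord.symm p ∈ D.coord.source}) :=
  D.smooth_translate z

/-- The chart of `D.Global` obtained by translating a chart of the coordinate manifold to `x`. -/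
def translatedChart (x : D.Global) (e : OpenPartialHomeomorph P E) :
    OpenPartialHomeomorph D.Global E :=
  ((D.translate x).symm.toOpenPartialHomeomorph.trans D.coord).trans e

variable {D}

theorem mem_translatedChart_source {x : D.Global} {e : OpenPartialHomeomorph P E} {y : D.Global} :
    y ∈ (D.translatedChart x e).source ↔
      x⁻¹ * y ∈ D.coord.source ∧ D.coord (x⁻¹ * y) ∈ e.source := by
  simp only [translatedChart, OpenPartialHomeomorph.trans_source, mem_inter_iff, mem_preimage,
    Homeomorph.toOpenPartialHomeomorph_source, mem_univ, true_and]
  rfl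

theorem mem_translatedChart_target {x : D.Global} {e : OpenPartialHomeomorph P E} {v : E} :
    v ∈ (D.translatedChart x e).target ↔ v ∈ e.target ∧ e.symm v ∈ D.coord.target := by
  simp only [translatedChart, OpenPartialHomeomorph.trans_target, mem_inter_iff, mem_preimage,
    Homeomorph.toOpenPartialHomeomorph_target, mem_univ, and_true, preimage_univ]

instance : ChartedSpace E D.Global where
  atlas := {c | ∃ x, ∃ e ∈ atlas E P, D.translatedChart x e = c}
  chartAt x := D.translatedChart x (chartAt E (D.coord 1))
  mem_chart_source x := by
    rw [mem_translatedChart_source, inv_mul_cancel]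
    exact ⟨D.one_mem_source, mem_chart_source E _⟩
  chart_mem_atlas x := ⟨x, _, chart_mem_atlas E _, rfl⟩

theorem mSmoothOn_mul_left (a : D.Global) : MSmoothOn 𝕜 E E (fun x => a * x) univ := by
  refine ⟨(D.continuous_mul_left a).continuousOn, ?_⟩
  rintro _ ⟨x, e, he, rfl⟩ _ ⟨y, e', he', rfl⟩ n
  have heq : D.translatedChart y e' ∘ (fun x => a * x) ∘ (D.translatedChart x e).symm =
      e' ∘ (fun p => D.coord (y⁻¹ * (a * x) * D.coord.symm p)) ∘ e.symm := by
    funext v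
    simp only [mul_assoc]
    rfl
  rw [heq]
  refine ((D.mSmoothOn_coord_mul_coord_symm (y⁻¹ * (a * x))).2 e he e' he' n).mono ?_
  rintro v ⟨hv, -, hv'⟩
  obtain ⟨hve, hvD⟩ := mem_translatedChart_target.1 hv
  obtain ⟨hsource, hchart⟩ := mem_translatedChart_source.1 hv'
  have hassoc : y⁻¹ * (a * x) * D.coord.symm (e.symm v) =
      y⁻¹ * (a * (D.translatedChart x e).symm v) := by
    simp only [mul_assoc]
    rfl
  rw [← hassoc] at hsource hchart
  exact ⟨hve, ⟨hvD, hsource⟩, hchart⟩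

instance : IsSmoothManifold 𝕜 E D.Global where
  compat c hc c' hc' n := by
    have h := (mSmoothOn_mul_left (1 : D.Global)).2 c hc c' hc' n
    simp only [one_mul] at h
    exact h.mono fun v hv => ⟨hv.1, mem_univ _, hv.2⟩

variable (D)

theorem mSmoothOn_coord : MSmoothOn 𝕜 E E D.coord D.coord.source := by
  refine ⟨D.coord.continuousOn, ?_⟩
  rintro _ ⟨x, e, he, rfl⟩ e' he' n
  refine ((D.mSmoothOn_coord_mul_coord_symm x).2 e he e' he' n).mono ?_
  rintro v ⟨hv, hv', hv''⟩
  obtain ⟨hve, hvD⟩ := mem_translatedChart_target.1 hv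
  exact ⟨hve, ⟨hvD, hv'⟩, hv''⟩

theorem mSmoothOn_coord_symm : MSmoothOn 𝕜 E E D.coord.symm D.coord.target := by
  refine ⟨D.coord.continuousOn_symm, ?_⟩
  rintro e he _ ⟨y, e', he', rfl⟩ n
  refine ((D.mSmoothOn_coord_mul_coord_symm y⁻¹).2 e he e' he' n).mono fun v hv => ?_
  have hv' : y⁻¹ * D.coord.symm (e.symm v) ∈ D.coord.source ∧
      D.coord (y⁻¹ * D.coord.symm (e.symm v)) ∈ e'.source :=
    mem_translatedChart_source.1 hv.2.2
  exact ⟨hv.1, ⟨hv.2.1, hv'.1⟩, hv'.2⟩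

end LeftCoordinates

end LeftCoordinates

section FactorSystems

/-- A factor set for `S` is a map `ω` with `δ_S = C_N ∘ ω` and `d_S ω = 1`. -/
structure IsFactorSet {G N : Type*} [Group G] [Group N] (S : G → MulAut N) (ω : G → G → N) :
    Prop where
  deltaMap_eq : ∀ g g', deltaMap S g g' = MulAut.conj (ω g g')
  dCochain_eq_one : ∀ a b c, dCochain S ω a b c = 1

/-- A factor system: normalized maps `S` and `ω` such that `ω` is a factor set for `S`. It makes
`N × G` into a group extension of `G` by `N`. -/
structure FactorSystem (G N : Type*) [Group G] [Group N] where
  S : G → MulAut N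
  ω : G → G → N
  map_one : S 1 = 1
  one_left : ∀ g, ω 1 g = 1
  one_right : ∀ g, ω g 1 = 1
  isFactorSet : IsFactorSet S ω

namespace FactorSystem

variable {G N : Type*} [Group G] [Group N] (A : FactorSystem G N)

/-- The crossed product of `N` and `G`: the set `N × G` with the multiplication
`(n, g) (n', g') = (n S(g)(n') ω(g, g'), g g')`. -/
@[ext] structure Crossed (_ : FactorSystem G N) where
  fiber : N
  base : G

variable {A}

namespace Crossed

instance : One A.Crossed := ⟨⟨1, 1⟩⟩

instance : Mul A.Crossed :=
  ⟨fun x y => ⟨x.fiber * A.S x.base y.fiber * A.ω x.base y.base, x.base * y.base⟩⟩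

instance : Inv A.Crossed :=
  ⟨fun x => ⟨(A.S x.base⁻¹ x.fiber * A.ω x.base⁻¹ x.base)⁻¹, x.base⁻¹⟩⟩

@[simp] theorem fiber_one : (1 : A.Crossed).fiber = 1 := rfl

@[simp] theorem base_one : (1 : A.Crossed).base = 1 := rfl

@[simp] theorem fiber_mul (x y : A.Crossed) :
    (x * y).fiber = x.fiber * A.S x.base y.fiber * A.ω x.base y.base := rfl

@[simp] theorem base_mul (x y : A.Crossed) : (x * y).base = x.base * y.base := rfl

@[simp] theorem fiber_inv (x : A.Crossed) :
    x⁻¹.fiber = (A.S x.base⁻¹ x.fiber * A.ω x.base⁻¹ x.base)⁻¹ := rfl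

@[simp] theorem base_inv (x : A.Crossed) : x⁻¹.base = x.base⁻¹ := rfl

protected theorem mul_assoc (x y z : A.Crossed) : x * y * z = x * (y * z) := by
  refine Crossed.ext ?_ (mul_assoc _ _ _)
  have hcocycle := dCochain_rel A.S A.ω x.base y.base z.base
  rw [A.isFactorSet.dCochain_eq_one, one_mul] at hcocycle
  calc x.fiber * A.S x.base y.fiber * A.ω x.base y.base * A.S (x.base * y.base) z.fiber *
          A.ω (x.base * y.base) z.base
      = x.fiber * A.S x.base y.fiber * (A.ω x.base y.base * A.S (x.base * y.base) z.fiber *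
          (A.ω x.base y.base)⁻¹) * (A.ω x.base y.base * A.ω (x.base * y.base) z.base) := by group
    _ = x.fiber * A.S x.base y.fiber * A.S x.base (A.S y.base z.fiber) *
          (A.S x.base (A.ω y.base z.base) * A.ω x.base (y.base * z.base)) := by
        rw [← conj_lift_apply A.isFactorSet.deltaMap_eq, hcocycle]
    _ = x.fiber * A.S x.base (y.fiber * A.S y.base z.fiber * A.ω y.base z.base) *
          A.ω x.base (y.base * z.base) := by simp only [map_mul, mul_assoc]

instance : Group A.Crossed :=
  Group.ofLeftAxioms Crossed.mul_assoc
    (fun x => Crossed.ext (by simp [A.map_one, A.one_left]) (one_mul _))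
    (fun x => Crossed.ext (by simp [mul_assoc]) (inv_mul_cancel _))

end Crossed

variable (A)

/-- The inclusion `n ↦ (n, 1)`. -/
def incl : N →* A.Crossed where
  toFun n := ⟨n, 1⟩
  map_one' := rfl
  map_mul' n n' := Crossed.ext (by simp [A.map_one, A.one_left]) (one_mul 1).symm

/-- The projection `(n, g) ↦ g`. -/
def proj : A.Crossed →* G where
  toFun x := x.base
  map_one' := rfl
  map_mul' _ _ := rfl

/-- The section `g ↦ (1, g)` of the projection. -/
def sec (g : G) : A.Crossed := ⟨1, g⟩

@[simp] theorem fiber_incl (n : N) : (A.incl n).fiber = n := rfl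

@[simp] theorem base_incl (n : N) : (A.incl n).base = 1 := rfl

@[simp] theorem fiber_sec (g : G) : (A.sec g).fiber = 1 := rfl

@[simp] theorem base_sec (g : G) : (A.sec g).base = g := rfl

theorem incl_injective : Function.Injective A.incl :=
  Function.LeftInverse.injective A.fiber_incl

theorem incl_fiber_of_mem_ker {x : A.Crossed} (hx : x ∈ A.proj.ker) : A.incl x.fiber = x :=
  Crossed.ext rfl hx.symm

theorem range_incl : A.incl.range = A.proj.ker :=
  le_antisymm (by rintro _ ⟨n, rfl⟩; rfl) fun _ hx => ⟨_, A.incl_fiber_of_mem_ker hx⟩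

theorem incl_mul_sec (x : A.Crossed) : A.incl x.fiber * A.sec x.base = x := by
  ext <;> simp [A.one_left]

theorem sec_mul_incl (g : G) (n : N) : A.sec g * A.incl n = A.incl (A.S g n) * A.sec g := by
  ext <;> simp [A.one_left, A.one_right]

theorem conj_incl (m : N) (x : A.Crossed) :
    A.incl m * x * (A.incl m)⁻¹ = ⟨m * x.fiber * A.S x.base m⁻¹, x.base⟩ := by
  rw [← map_inv]
  ext <;> simp [A.map_one, A.one_left, A.one_right]

theorem conj_sec (g : G) (x : A.Crossed) : A.sec g * x * (A.sec g)⁻¹ =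
    ⟨A.S g x.fiber * (A.ω g x.base * (A.ω (g * x.base * g⁻¹) g)⁻¹), g * x.base * g⁻¹⟩ := by
  rw [mul_inv_eq_iff_eq_mul]
  ext <;> simp [mul_assoc]

end FactorSystem

end FactorSystems

section Slices

variable {𝕜 : Type*} [RCLike 𝕜]
  {E : Type*} [AddCommGroup E] [Module 𝕜 E] [TopologicalSpace E] [IsTopologicalAddGroup E]
  [ContinuousSMul 𝕜 E] [PolynormableSpace 𝕜 E] [T2Space E]
  {F : Type*} [AddCommGroup F] [Module 𝕜 F] [TopologicalSpace F] [PolynormableSpace 𝕜 F]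
  [T2Space F]
  {G : Type*} [Group G] [TopologicalSpace G] [ChartedSpace E G] [IsLieGroup 𝕜 E G]
  {M : Type*} [TopologicalSpace M] [ChartedSpace F M]

theorem LocallySmooth.exists_mSmoothOn_slice {f : G × G → M}
    (hf : LocallySmooth 𝕜 (E × E) F f) : ∃ U : Set G, IsOpen U ∧ 1 ∈ U ∧
      ∀ g, MSmoothOn 𝕜 E F (fun u => f (g, u)) (U ∩ {u | g * u ∈ U}) := by
  have := IsLieGroup.isTopologicalGroup 𝕜 E G
  obtain ⟨O, hO, h1, hf⟩ := hf
  -- If `u` and `gu` are close to `1`, then `(g, u) = ((gu)u⁻¹, u)` is close to `(1, 1)`.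
  have hcont : Continuous fun p : G × G => (p.1 * p.2⁻¹, p.2) := by fun_prop
  have hmem : (fun p : G × G => (p.1 * p.2⁻¹, p.2)) ⁻¹' O ∈ 𝓝 ((1 : G), (1 : G)) :=
    (hO.preimage hcont).mem_nhds (by simpa [Prod.one_eq_mk] using h1)
  rw [nhds_prod_eq, mem_prod_same_iff] at hmem
  obtain ⟨V, hV, hVO⟩ := hmem
  obtain ⟨U, hUV, hU, h1U⟩ := mem_nhds_iff.1 hV
  refine ⟨U, hU, h1U, fun g => hf.comp ((mSmoothOn_const g _).prodMk (mSmoothOn_id _))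
    (hU.inter (hU.preimage (continuous_const_mul g))) hO fun u hu => ?_⟩
  simpa using hVO (mk_mem_prod (hUV hu.2) (hUV hu.1))

end Slices

section SmoothFactorSystems

variable (𝕜 : Type*) [RCLike 𝕜]
  (E : Type*) [AddCommGroup E] [Module 𝕜 E] [TopologicalSpace E]
  (F : Type*) [AddCommGroup F] [Module 𝕜 F] [TopologicalSpace F]
  (G : Type*) [Group G] [TopologicalSpace G] [ChartedSpace E G]
  (N : Type*) [Group N] [TopologicalSpace N] [ChartedSpace F N]

/-- A factor system whose members are smooth near the identity. -/
structure SmoothFactorSystem extends FactorSystem G N where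
  isC1Aut : IsC1Aut 𝕜 E F S
  isC2 : IsC2 𝕜 E F ω
  map_one := isC1Aut.map_one
  one_left := isC2.one_left
  one_right := isC2.one_right

variable {𝕜 E F G N}

theorem IsC1Aut.locallySmooth_uncurry {S : G → MulAut N} (hS : IsC1Aut 𝕜 E F S) :
    LocallySmooth 𝕜 (E × F) F (fun p : G × N => S p.1 p.2) := by
  obtain ⟨U, hU, h1, hs⟩ := hS.smooth_near_one
  exact ⟨_, hU.prod isOpen_univ, ⟨h1, mem_univ _⟩, hs⟩

variable [IsTopologicalAddGroup E] [ContinuousSMul 𝕜 E]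

theorem IsC1Aut.locallySmooth_orbit [PolynormableSpace 𝕜 F] [T2Space F] [IsTopologicalAddGroup F]
    [ContinuousSMul 𝕜 F] [IsSmoothManifold 𝕜 E G] {S : G → MulAut N} (hS : IsC1Aut 𝕜 E F S)
    (n : N) : LocallySmooth 𝕜 E F (fun g => S g n) := by
  obtain ⟨U, hU, h1, hs⟩ := hS.smooth_near_one
  exact ⟨U, hU, h1, hs.comp ((mSmoothOn_id U).prodMk (mSmoothOn_const n U)) hU
    (hU.prod isOpen_univ) fun _ hg => ⟨hg, mem_univ _⟩⟩

end SmoothFactorSystems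

namespace SmoothFactorSystem

variable {𝕜 : Type*} [RCLike 𝕜]
  {E : Type*} [AddCommGroup E] [Module 𝕜 E] [TopologicalSpace E] [IsTopologicalAddGroup E]
  [ContinuousSMul 𝕜 E] [PolynormableSpace 𝕜 E] [T2Space E]
  {F : Type*} [AddCommGroup F] [Module 𝕜 F] [TopologicalSpace F] [PolynormableSpace 𝕜 F]
  [T2Space F]
  {G : Type*} [Group G] [TopologicalSpace G] [ChartedSpace E G] [IsLieGroup 𝕜 E G]
  {N : Type*} [Group N] [TopologicalSpace N] [ChartedSpace F N]
  (A : SmoothFactorSystem 𝕜 E F G N)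

/-- An open identity neighbourhood of `G` on which the slices of `ω` are smooth. -/
def baseNhd : Set G := A.isC2.locallySmooth.exists_mSmoothOn_slice.choose

theorem isOpen_baseNhd : IsOpen A.baseNhd :=
  A.isC2.locallySmooth.exists_mSmoothOn_slice.choose_spec.1

theorem one_mem_baseNhd : 1 ∈ A.baseNhd :=
  A.isC2.locallySmooth.exists_mSmoothOn_slice.choose_spec.2.1

theorem mSmoothOn_ω (g : G) : MSmoothOn 𝕜 E F (A.ω g) (A.baseNhd ∩ {u | g * u ∈ A.baseNhd}) :=
  A.isC2.locallySmooth.exists_mSmoothOn_slice.choose_spec.2.2 g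

theorem isOpen_baseNhd_inter (g : G) : IsOpen (A.baseNhd ∩ {u | g * u ∈ A.baseNhd}) :=
  have := IsLieGroup.isTopologicalGroup 𝕜 E G
  A.isOpen_baseNhd.inter (A.isOpen_baseNhd.preimage (continuous_const_mul g))

variable [IsTopologicalAddGroup F] [ContinuousSMul 𝕜 F] [IsLieGroup 𝕜 F N]

/-- The identification of the crossed product with `N × G`, over a neighbourhood of `1` in `G`. -/
def leftCoordinates : LeftCoordinates 𝕜 (F × E) (N × G) A.Crossed where
  toFun x := (x.fiber, x.base)
  invFun p := ⟨p.1, p.2⟩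
  source := {x | x.base ∈ A.baseNhd}
  target := Prod.snd ⁻¹' A.baseNhd
  map_source' _ hx := hx
  map_target' _ hp := hp
  left_inv' _ _ := rfl
  right_inv' _ _ := rfl
  one_mem_source := A.one_mem_baseNhd
  isOpen_target := A.isOpen_baseNhd.preimage continuous_snd
  isOpen_translate z := (A.isOpen_baseNhd_inter z.base).preimage continuous_snd
  smooth_translate z := by
    have hO := (A.isOpen_baseNhd_inter z.base).preimage (continuous_snd (X := N))
    have hω := (A.mSmoothOn_ω z.base).comp_preimage (mSmoothOn_snd (M := N) (E := F) univ)
      (A.isOpen_baseNhd_inter z.base)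
    have hS := (A.isC1Aut.isLieAut z.base).1.comp
      (mSmoothOn_fst (M' := G) (E' := E) (Prod.snd ⁻¹' (A.baseNhd ∩ {u | z.base * u ∈ A.baseNhd})))
      hO isOpen_univ (mapsTo_univ _ _)
    exact (((mSmoothOn_const z.fiber _).mul hS hO).mul hω hO).prodMk
      ((mSmoothOn_const z.base _).mul (mSmoothOn_snd _) hO)

instance : TopologicalSpace A.Crossed := inferInstanceAs (TopologicalSpace A.leftCoordinates.Global)

instance : ChartedSpace (F × E) A.Crossed :=
  inferInstanceAs (ChartedSpace (F × E) A.leftCoordinates.Global)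

instance : IsSmoothManifold 𝕜 (F × E) A.Crossed :=
  inferInstanceAs (IsSmoothManifold 𝕜 (F × E) A.leftCoordinates.Global)

theorem mSmoothOn_coordinates : MSmoothOn 𝕜 (F × E) (F × E)
    (fun x : A.Crossed => (x.fiber, x.base)) (A.proj ⁻¹' A.baseNhd) :=
  A.leftCoordinates.mSmoothOn_coord

theorem isOpen_proj_preimage_baseNhd : IsOpen (A.proj ⁻¹' A.baseNhd) :=
  A.leftCoordinates.isOpen_partialCoord_source

theorem mSmoothOn_mk : MSmoothOn 𝕜 (F × E) (F × E)
    (fun p : N × G => (⟨p.1, p.2⟩ : A.Crossed)) (Prod.snd ⁻¹' A.baseNhd) :=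
  A.leftCoordinates.mSmoothOn_coord_symm

theorem mSmoothOn_fiber :
    MSmoothOn 𝕜 (F × E) F (fun x : A.Crossed => x.fiber) (A.proj ⁻¹' A.baseNhd) :=
  (mSmoothOn_fst univ).comp A.mSmoothOn_coordinates A.isOpen_proj_preimage_baseNhd isOpen_univ
    (mapsTo_univ _ _)

theorem locallySmooth_fiber : LocallySmooth 𝕜 (F × E) F (fun x : A.Crossed => x.fiber) :=
  ⟨_, A.isOpen_proj_preimage_baseNhd, A.one_mem_baseNhd, A.mSmoothOn_fiber⟩

theorem locallySmooth_base : LocallySmooth 𝕜 (F × E) E (fun x : A.Crossed => x.base) :=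
  (mSmoothOn_snd univ).locallySmooth_comp
    ⟨_, A.isOpen_proj_preimage_baseNhd, A.one_mem_baseNhd, A.mSmoothOn_coordinates⟩

variable {A} in
theorem locallySmooth_crossedMk {E' : Type*} [AddCommGroup E'] [Module 𝕜 E'] [TopologicalSpace E']
    [IsTopologicalAddGroup E'] [ContinuousSMul 𝕜 E'] {M : Type*} [One M] [TopologicalSpace M]
    [ChartedSpace E' M] {f : M → N} {g : M → G} (hf : LocallySmooth 𝕜 E' F f)
    (hg : LocallySmooth 𝕜 E' E g) (hf1 : f 1 = 1) (hg1 : g 1 = 1) :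
    LocallySmooth 𝕜 E' (F × E) (fun x => (⟨f x, g x⟩ : A.Crossed)) :=
  LocallySmooth.comp ⟨_, A.isOpen_baseNhd.preimage continuous_snd, mem_preimage.2 A.one_mem_baseNhd,
    A.mSmoothOn_mk⟩ (hf.prodMk hg) (Prod.ext hf1 hg1)

instance : IsLocallyLieGroup 𝕜 (F × E) A.Crossed where
  mSmoothOn_mul_left := LeftCoordinates.mSmoothOn_mul_left (D := A.leftCoordinates)
  locallySmooth_mul := by
    have hn := A.locallySmooth_fiber.comp (locallySmooth_fst (M' := A.Crossed) (E' := F × E)) rfl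
    have hg := A.locallySmooth_base.comp (locallySmooth_fst (M' := A.Crossed) (E' := F × E)) rfl
    have hn' := A.locallySmooth_fiber.comp (locallySmooth_snd (M := A.Crossed) (E := F × E)) rfl
    have hg' := A.locallySmooth_base.comp (locallySmooth_snd (M := A.Crossed) (E := F × E)) rfl
    exact locallySmooth_crossedMk
      ((hn.mul (A.isC1Aut.locallySmooth_uncurry.comp (hg.prodMk hn') rfl)).mul
        (A.isC2.locallySmooth.comp (hg.prodMk hg') rfl))
      (hg.mul hg') (by simp [A.one_left]) (by simp)
  locallySmooth_inv := by
    have hn := A.locallySmooth_fiber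
    have hg := A.locallySmooth_base
    exact locallySmooth_crossedMk
      ((A.isC1Aut.locallySmooth_uncurry.comp (hg.inv.prodMk hn) (Prod.ext inv_one rfl)).mul
        (A.isC2.locallySmooth.comp (hg.inv.prodMk hg) (Prod.ext inv_one rfl))).inv
      hg.inv (by simp [A.one_right]) (by simp)

theorem locallySmooth_conj_incl (m : N) :
    LocallySmooth 𝕜 (F × E) (F × E) (fun x : A.Crossed => A.incl m * x * (A.incl m)⁻¹) := by
  simp only [A.conj_incl]
  exact locallySmooth_crossedMk (((locallySmooth_const m).mul A.locallySmooth_fiber).mul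
    ((A.isC1Aut.locallySmooth_orbit m⁻¹).comp A.locallySmooth_base rfl)) A.locallySmooth_base
    (by simp [A.map_one]) rfl

theorem locallySmooth_conj_sec {g : G}
    (h : LocallySmooth 𝕜 E F (fun x => A.ω g x * (A.ω (g * x * g⁻¹) g)⁻¹)) :
    LocallySmooth 𝕜 (F × E) (F × E) (fun x : A.Crossed => A.sec g * x * (A.sec g)⁻¹) := by
  simp only [A.conj_sec]
  exact locallySmooth_crossedMk
    (((A.isC1Aut.isLieAut g).1.locallySmooth_comp A.locallySmooth_fiber).mul
      (h.comp A.locallySmooth_base rfl))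
    (((locallySmooth_const g).mul A.locallySmooth_base).mul (locallySmooth_const g⁻¹))
    (by simp [A.one_left, A.one_right]) (by simp)

theorem isLieGroup_of_isC2ss (hω : IsC2ss 𝕜 E F A.ω) : IsLieGroup 𝕜 (F × E) A.Crossed := by
  have hconj (z : A.Crossed) : LocallySmooth 𝕜 (F × E) (F × E) (fun x => z * x * z⁻¹) := by
    rw [← A.incl_mul_sec z]
    exact locallySmooth_conj_mul (A.locallySmooth_conj_incl _)
      (A.locallySmooth_conj_sec (hω.locallySmooth_twist _))
  exact isLieGroup_of_smoothConj_eq_top (eq_top_iff.2 fun z _ => ⟨hconj z, hconj z⁻¹⟩)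

theorem ker_proj_le_smoothConj : A.proj.ker ≤ smoothConj 𝕜 (F × E) A.Crossed := by
  rw [← A.range_incl]
  rintro _ ⟨n, rfl⟩
  exact ⟨A.locallySmooth_conj_incl n, by
    simpa only [map_inv] using A.locallySmooth_conj_incl n⁻¹⟩

theorem mSmoothOn_sec : MSmoothOn 𝕜 E (F × E) A.sec A.baseNhd :=
  A.mSmoothOn_mk.comp_preimage ((mSmoothOn_const (1 : N) univ).prodMk (mSmoothOn_id univ))
    (A.isOpen_baseNhd.preimage continuous_snd)

theorem isC1_sec : IsC1 𝕜 E (F × E) A.sec :=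
  ⟨rfl, A.baseNhd, A.isOpen_baseNhd, A.one_mem_baseNhd, A.mSmoothOn_sec⟩

theorem isLieGroup_of_connectedSpace [ConnectedSpace G] : IsLieGroup 𝕜 (F × E) A.Crossed :=
  have := IsLieGroup.isTopologicalGroup 𝕜 E G
  isLieGroup_of_smoothConj_eq_top <| subgroup_eq_top_of_ker_le
    (A.mSmoothOn_sec.1.continuousAt (A.isOpen_baseNhd.mem_nhds A.one_mem_baseNhd)) rfl A.base_sec
    smoothConj_mem_nhds_one A.ker_proj_le_smoothConj

theorem mSmoothOn_incl : MSmoothOn 𝕜 F (F × E) A.incl univ :=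
  A.mSmoothOn_mk.comp ((mSmoothOn_id univ).prodMk (mSmoothOn_const (1 : G) univ)) isOpen_univ
    (A.isOpen_baseNhd.preimage continuous_snd) fun _ _ => A.one_mem_baseNhd

theorem mSmoothOn_proj : MSmoothOn 𝕜 (F × E) E A.proj univ :=
  IsLocallyLieGroup.mSmoothOn_monoidHom A.proj A.locallySmooth_base

end SmoothFactorSystem

section LocalTriviality

variable {𝕜 : Type*} [RCLike 𝕜]
  {E : Type*} [AddCommGroup E] [Module 𝕜 E] [TopologicalSpace E] [IsTopologicalAddGroup E]
  [ContinuousSMul 𝕜 E]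
  {E' : Type*} [AddCommGroup E'] [Module 𝕜 E'] [TopologicalSpace E'] [IsTopologicalAddGroup E']
  [ContinuousSMul 𝕜 E'] [PolynormableSpace 𝕜 E'] [T2Space E']
  {G : Type*} [Group G] [TopologicalSpace G] [ChartedSpace E G]
  {Q : Type*} [Group Q] [TopologicalSpace Q] [ChartedSpace E' Q]

theorem LocallySmooth.exists_local_section [IsLocallyLieGroup 𝕜 E G] [IsLocallyLieGroup 𝕜 E' Q]
    {q : Q →* G} {σ : G → Q} (hσ : LocallySmooth 𝕜 E E' σ) (hqσ : ∀ g, q (σ g) = g) (g₀ : G) :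
    ∃ U : Set G, IsOpen U ∧ g₀ ∈ U ∧ ∃ τ : G → Q, MSmoothOn 𝕜 E E' τ U ∧ ∀ g, q (τ g) = g := by
  obtain ⟨V, hV, h1, hσ⟩ := hσ
  have htranslate := IsLocallyLieGroup.mSmoothOn_mul_left (𝕜 := 𝕜) (E := E) g₀⁻¹
  have hU := hV.preimage htranslate.continuous
  refine ⟨_, hU, by simpa using h1, fun g => σ g₀ * σ (g₀⁻¹ * g), ?_, fun g => by simp [hqσ]⟩
  exact (IsLocallyLieGroup.mSmoothOn_mul_left (σ g₀)).comp (hσ.comp_preimage htranslate hV) hU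
    isOpen_univ (mapsTo_univ _ _)

variable {F : Type*} [AddCommGroup F] [Module 𝕜 F] [TopologicalSpace F] [IsTopologicalAddGroup F]
  [ContinuousSMul 𝕜 F] [PolynormableSpace 𝕜 F] [T2Space F]
  {N : Type*} [Group N] [TopologicalSpace N] [ChartedSpace F N] [IsSmoothManifold 𝕜 F N]
  [IsSmoothManifold 𝕜 E G] [IsLieGroup 𝕜 E' Q]

theorem exists_trivialization_of_section {ι : N →* Q} {q : Q →* G}
    (hι : MSmoothOn 𝕜 F E' ι univ) (hq : MSmoothOn 𝕜 E' E q univ) (hrange : ι.range = q.ker)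
    {O : Set Q} (hO : IsOpen O) (hker : (q.ker : Set Q) ⊆ O) {ρ : Q → N}
    (hρ : MSmoothOn 𝕜 E' F ρ O) (hρι : ∀ n, ρ (ι n) = n)
    {U : Set G} (hU : IsOpen U) {τ : G → Q} (hτ : MSmoothOn 𝕜 E E' τ U) (hqτ : ∀ g, q (τ g) = g) :
    ∃ (Φ : G × N → Q) (Ψ : Q → N),
      MSmoothOn 𝕜 (E × F) E' Φ (U ×ˢ univ) ∧ MSmoothOn 𝕜 E' F Ψ (q ⁻¹' U) ∧
      (∀ g ∈ U, ∀ n, q (Φ (g, n)) = g ∧ Ψ (Φ (g, n)) = n) ∧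
      (∀ x, q x ∈ U → Φ (q x, Ψ x) = x) ∧
      ∀ g ∈ U, ∀ n n', Φ (g, n * n') = Φ (g, n) * ι n' := by
  have hqι (n : N) : q (ι n) = 1 := hrange.le ⟨n, rfl⟩
  have hmem_ker (x : Q) : (τ (q x))⁻¹ * x ∈ q.ker := by simp [MonoidHom.mem_ker, hqτ]
  have hW : IsOpen (U ×ˢ (univ : Set N)) := hU.prod isOpen_univ
  have hqU : IsOpen (q ⁻¹' U) := hU.preimage hq.continuous
  refine ⟨fun p => τ p.1 * ι p.2, fun x => ρ ((τ (q x))⁻¹ * x), ?_, ?_, ?_, ?_, ?_⟩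
  · exact (hτ.comp (mSmoothOn_fst _) hW hU fun _ hp => hp.1).mul
      (hι.comp (mSmoothOn_snd _) hW isOpen_univ (mapsTo_univ _ _)) hW
  · exact hρ.comp (((hτ.comp_preimage hq hU).inv hqU).mul (mSmoothOn_id _) hqU) hqU hO
      fun x _ => hker (hmem_ker x)
  · exact fun g _ n => by simp [hqι, hqτ, hρι]
  · intro x _
    obtain ⟨n, hn⟩ := hrange.ge (hmem_ker x)
    simp only [← hn, hρι]
    exact eq_inv_mul_iff_mul_eq.1 hn
  · exact fun g _ n n' => by simp only [map_mul, mul_assoc]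

end LocalTriviality

namespace SmoothFactorSystem

variable {𝕜 : Type*} [RCLike 𝕜]
  {E : Type*} [AddCommGroup E] [Module 𝕜 E] [TopologicalSpace E] [IsTopologicalAddGroup E]
  [ContinuousSMul 𝕜 E] [PolynormableSpace 𝕜 E] [T2Space E]
  {F : Type*} [AddCommGroup F] [Module 𝕜 F] [TopologicalSpace F] [IsTopologicalAddGroup F]
  [ContinuousSMul 𝕜 F] [PolynormableSpace 𝕜 F] [T2Space F]
  {G : Type*} [Group G] [TopologicalSpace G] [ChartedSpace E G] [IsLieGroup 𝕜 E G]
  {N : Type*} [Group N] [TopologicalSpace N] [ChartedSpace F N] [IsLieGroup 𝕜 F N]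
  (A : SmoothFactorSystem 𝕜 E F G N) [IsLieGroup 𝕜 (F × E) A.Crossed]

/-- The crossed product of a smooth factor system as a Lie group extension of `G` by `N`. -/
def extension : LieGroupExtension 𝕜 E F G N where
  Model := F × E
  Total := A.Crossed
  ι := A.incl
  q := A.proj
  ι_injective := A.incl_injective
  range_ι := A.range_incl
  q_surjective g := ⟨A.sec g, A.base_sec g⟩
  ι_smooth := A.mSmoothOn_incl
  q_smooth := A.mSmoothOn_proj
  locallyTrivial g₀ := by
    obtain ⟨U, hU, hg₀, τ, hτ, hqτ⟩ :=
      A.isC1_sec.locallySmooth.exists_local_section (q := A.proj) A.base_sec g₀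
    refine ⟨U, hU, hg₀, exists_trivialization_of_section A.mSmoothOn_incl A.mSmoothOn_proj
      A.range_incl A.isOpen_proj_preimage_baseNhd ?_ A.mSmoothOn_fiber A.fiber_incl hU hτ hqτ⟩
    exact fun x hx => mem_preimage.2 (hx.symm ▸ A.one_mem_baseNhd)

theorem extension_correspondsTo : A.extension.CorrespondsTo A.S :=
  ⟨A.sec, A.S, ⟨A.isC1_sec, A.base_sec⟩,
    fun g n => eq_mul_inv_of_mul_eq (A.sec_mul_incl g n).symm,
    1, ⟨rfl, locallySmooth_const 1⟩, fun g => by simp⟩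

end SmoothFactorSystem

theorem isFactorSet_of_section {G N H : Type*} [Group G] [Group N] [Group H] {ι : N →* H}
    (hι : Function.Injective ι) {τ : G → H} {S : G → MulAut N} {ω : G → G → N}
    (hS : ∀ g n, ι (S g n) = τ g * ι n * (τ g)⁻¹)
    (hω : ∀ g g', ι (ω g g') = τ g * τ g' * (τ (g * g'))⁻¹) : IsFactorSet S ω where
  deltaMap_eq g g' := by
    rw [deltaMap, mul_inv_eq_iff_eq_mul]
    ext n
    apply hι
    simp only [MulAut.mul_apply, MulAut.conj_apply, map_mul, map_inv, hS, hω]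
    group
  dCochain_eq_one a b c := hι <| by
    simp only [dCochain, map_mul, map_inv, hS, hω, map_one, mul_assoc a b c]
    group

namespace LieGroupExtension

variable {𝕜 : Type*} [RCLike 𝕜]
  {E : Type*} [AddCommGroup E] [Module 𝕜 E] [TopologicalSpace E]
  {F : Type*} [AddCommGroup F] [Module 𝕜 F] [TopologicalSpace F]
  {G : Type*} [Group G] [TopologicalSpace G] [ChartedSpace E G]
  {N : Type*} [Group N] [TopologicalSpace N] [ChartedSpace F N]
  (X : LieGroupExtension 𝕜 E F G N)

theorem q_ι (n : N) : X.q (X.ι n) = 1 :=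
  X.range_ι.le ⟨n, rfl⟩

variable {X} in
theorem IsSection.exists_map_ι_eq {τ : G → X.Total} (hτ : X.IsSection τ) :
    ∃ ω : G → G → N, ∀ g g', X.ι (ω g g') = τ g * τ g' * (τ (g * g'))⁻¹ := by
  have hker (g g' : G) : τ g * τ g' * (τ (g * g'))⁻¹ ∈ X.q.ker := by
    simp [MonoidHom.mem_ker, hτ.q_apply]
  choose ω hω using fun g g' => X.range_ι.ge (hker g g')
  exact ⟨ω, hω⟩

variable [PolynormableSpace 𝕜 F] [T2Space F]

theorem locallySmooth_of_ι_comp {E' : Type*} [AddCommGroup E'] [Module 𝕜 E']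
    [TopologicalSpace E'] [IsTopologicalAddGroup E'] [ContinuousSMul 𝕜 E'] {M : Type*} [One M]
    [TopologicalSpace M] [ChartedSpace E' M] {f : M → N}
    (h : LocallySmooth 𝕜 E' X.Model (fun x => X.ι (f x))) : LocallySmooth 𝕜 E' F f := by
  obtain ⟨U, hU, hU1, Φ, Ψ, -, hΨ, hΦΨ, -, hι⟩ := X.locallyTrivial 1
  have hΦι (n : N) : Φ (1, 1) * X.ι n = Φ (1, n) := by rw [← hι 1 hU1, one_mul]
  obtain ⟨O, hO, h1, hf⟩ := h
  refine ⟨O, hO, h1, (hΨ.comp ((mSmoothOn_const (Φ (1, 1)) O).mul hf hO) hO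
    (hU.preimage X.q_smooth.continuous) fun x _ => ?_).congr hO fun x _ => ?_⟩
  · rwa [mem_preimage, hΦι, (hΦΨ 1 hU1 _).1]
  · rw [Function.comp, hΦι, (hΦΨ 1 hU1 _).2]

variable {X} [IsTopologicalAddGroup E] [ContinuousSMul 𝕜 E]

theorem CorrespondsTo.exists_section [IsTopologicalAddGroup F] [ContinuousSMul 𝕜 F]
    {S : G → MulAut N} (hX : X.CorrespondsTo S) :
    ∃ τ : G → X.Total, X.IsSection τ ∧ ∀ g n, X.ι (S g n) = τ g * X.ι n * (τ g)⁻¹ := by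
  obtain ⟨σ, S', ⟨⟨hσ1, hσs⟩, hσq⟩, hσ, h, ⟨hh1, hhs⟩, hSS⟩ := hX
  refine ⟨fun g => (X.ι (h g))⁻¹ * σ g, ⟨⟨by simp [hσ1, hh1],
    (X.ι_smooth.locallySmooth_comp hhs).inv.mul hσs⟩, fun g => by simp [X.q_ι, hσq]⟩,
    fun g n => ?_⟩
  have hconj : X.ι (h g) * X.ι (S g n) * (X.ι (h g))⁻¹ = σ g * X.ι n * (σ g)⁻¹ := by
    simp only [← hσ, hSS, MulAut.mul_apply, MulAut.conj_apply, map_mul, map_inv]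
  calc X.ι (S g n)
      = (X.ι (h g))⁻¹ * (X.ι (h g) * X.ι (S g n) * (X.ι (h g))⁻¹) * X.ι (h g) := by group
    _ = (X.ι (h g))⁻¹ * σ g * X.ι n * ((X.ι (h g))⁻¹ * σ g)⁻¹ := by rw [hconj]; group

variable [PolynormableSpace 𝕜 E] [T2Space E] [IsLieGroup 𝕜 E G]

theorem isC2ss_of_section {τ : G → X.Total} (hτ : IsC1 𝕜 E X.Model τ) {ω : G → G → N}
    (hω : ∀ g g', X.ι (ω g g') = τ g * τ g' * (τ (g * g'))⁻¹) : IsC2ss 𝕜 E F ω where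
  one_left g := X.ι_injective (by simp [hω, hτ.map_one])
  one_right g := X.ι_injective (by simp [hω, hτ.map_one])
  locallySmooth := by
    have hfst : LocallySmooth 𝕜 (E × E) E (fun p : G × G => p.1) := locallySmooth_fst
    have hsnd : LocallySmooth 𝕜 (E × E) E (fun p : G × G => p.2) := locallySmooth_snd
    apply X.locallySmooth_of_ι_comp
    simp only [hω]
    exact ((hτ.locallySmooth.comp hfst rfl).mul (hτ.locallySmooth.comp hsnd rfl)).mul
      (hτ.locallySmooth.comp (hfst.mul hsnd) (mul_one 1)).inv
  locallySmooth_twist g := by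
    have htwist (x : G) : X.ι (ω g x * (ω (g * x * g⁻¹) g)⁻¹) =
        τ g * τ x * (τ g)⁻¹ * (τ (g * x * g⁻¹))⁻¹ := by
      simp only [map_mul, map_inv, hω, inv_mul_cancel_right]
      group
    have hconj : LocallySmooth 𝕜 E E (fun x : G => g * x * g⁻¹) :=
      ((locallySmooth_const g).mul locallySmooth_id).mul (locallySmooth_const g⁻¹)
    apply X.locallySmooth_of_ι_comp
    simp only [htwist]
    exact (((locallySmooth_const (τ g)).mul hτ.locallySmooth).mul (locallySmooth_const _)).mul
      (hτ.locallySmooth.comp hconj (by simp)).inv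

theorem CorrespondsTo.exists_isFactorSet [IsTopologicalAddGroup F] [ContinuousSMul 𝕜 F]
    {S : G → MulAut N} (hX : X.CorrespondsTo S) :
    ∃ ω : G → G → N, IsC2ss 𝕜 E F ω ∧ IsFactorSet S ω := by
  obtain ⟨τ, hτ, hτS⟩ := hX.exists_section
  obtain ⟨ω, hω⟩ := hτ.exists_map_ι_eq
  exact ⟨ω, isC2ss_of_section hτ.isC1 hω, isFactorSet_of_section X.ι_injective hτS hω⟩

end LieGroupExtension

section CharacteristicClass

open scoped IsMulCommutative

theorem IsFactorSet.dCentral_eq_one {G N : Type*} [Group G] [Group N] {S : G → MulAut N}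
    {ω : G → G → N} (hω : IsFactorSet S ω) : dCentral hω.deltaMap_eq = 1 :=
  funext fun a => funext fun b => funext fun c => Subtype.ext (hω.dCochain_eq_one a b c)

theorem isFactorSet_mul_inv {G N : Type*} [Group G] [Group N] {S : G → MulAut N} {ω : G → G → N}
    {β : G → G → Subgroup.center N} (h : ∀ g g', deltaMap S g g' = MulAut.conj (ω g g'))
    (hβ : d₂ S β = dCentral h) : IsFactorSet S fun g g' => ω g g' * β⁻¹ g g' where
  deltaMap_eq g g' := by
    rw [h, map_mul]
    ext n
    simp [Subgroup.mem_center_iff.1 (β g g').2 n, mul_assoc]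
  dCochain_eq_one a b c := by
    rw [dCochain_mul_central (fun x y => (β⁻¹ x y).2), ← coe_d₂, map_inv, hβ]
    exact mul_inv_cancel (dCochain S ω a b c)

variable {𝕜 : Type*} [RCLike 𝕜]
  {E : Type*} [AddCommGroup E] [Module 𝕜 E] [TopologicalSpace E] [IsTopologicalAddGroup E]
  [ContinuousSMul 𝕜 E]
  {F : Type*} [AddCommGroup F] [Module 𝕜 F] [TopologicalSpace F] [IsTopologicalAddGroup F]
  [ContinuousSMul 𝕜 F] [PolynormableSpace 𝕜 F] [T2Space F]
  {G : Type*} [Group G] [TopologicalSpace G] [ChartedSpace E G]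
  {N : Type*} [Group N] [TopologicalSpace N] [ChartedSpace F N] [IsLieGroup 𝕜 F N]
  {ω : G → G → N} {β : G → G → Subgroup.center N}

theorem IsC2.mul_center (hω : IsC2 𝕜 E F ω) (hβ : β ∈ C₂Center 𝕜 E F G N) :
    IsC2 𝕜 E F fun g g' => ω g g' * β g g' where
  one_left g := by simpa [hω.one_left] using hβ.one_left g
  one_right g := by simpa [hω.one_right] using hβ.one_right g
  locallySmooth := hω.locallySmooth.mul hβ.locallySmooth

theorem IsC2ss.mul_center (hω : IsC2ss 𝕜 E F ω) (hβ : β ∈ C₂ssCenter 𝕜 E F G N) :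
    IsC2ss 𝕜 E F fun g g' => ω g g' * β g g' where
  toIsC2 := hω.toIsC2.mul_center hβ.toIsC2
  locallySmooth_twist g := by
    convert (hω.locallySmooth_twist g).mul (hβ.locallySmooth_twist g) using 2 with x
    have hcomm := Subgroup.mem_center_iff.1 (β g x * (β (g * x * g⁻¹) g)⁻¹).2
      (ω (g * x * g⁻¹) g)⁻¹
    simp only [Subgroup.coe_mul, Subgroup.coe_inv] at hcomm
    rw [mul_assoc (ω g x) (ω _ g)⁻¹, hcomm]
    group

variable [PolynormableSpace 𝕜 E] [T2Space E] [IsLieGroup 𝕜 E G] {S : G → MulAut N}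

theorem charClassSs_eq_one_iff (hS : IsStronglySmoothOuterAction 𝕜 E F S) :
    charClassSs hS = 1 ↔ ∃ ω : G → G → N, IsC2ss 𝕜 E F ω ∧ IsFactorSet S ω := by
  constructor
  · intro h
    obtain ⟨hω, hd⟩ := hS.exists_lift.choose_spec
    obtain ⟨β, hβ, hdβ⟩ := (QuotientGroup.eq_one_iff _).1 h
    exact ⟨_, hω.mul_center (inv_mem hβ), isFactorSet_mul_inv hd hdβ⟩
  · rintro ⟨ω, hω, h⟩
    refine (charClassSsOf_eq hS.isC1Aut _ _ hω h.deltaMap_eq).trans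
      ((QuotientGroup.eq_one_iff _).2 ?_)
    exact ⟨1, one_mem _, (map_one _).trans h.dCentral_eq_one.symm⟩

theorem charClassS_eq_one_iff (hS : IsSmoothOuterAction 𝕜 E F S) :
    charClassS hS = 1 ↔ ∃ ω : G → G → N, IsC2 𝕜 E F ω ∧ IsFactorSet S ω := by
  constructor
  · intro h
    obtain ⟨hω, hd⟩ := hS.exists_lift.choose_spec
    obtain ⟨β, hβ, hdβ⟩ := (QuotientGroup.eq_one_iff _).1 h
    exact ⟨_, hω.mul_center (inv_mem hβ), isFactorSet_mul_inv hd hdβ⟩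
  · rintro ⟨ω, hω, h⟩
    refine (charClassSOf_eq hS.isC1Aut _ _ hω h.deltaMap_eq).trans
      ((QuotientGroup.eq_one_iff _).2 ?_)
    exact ⟨1, one_mem _, (map_one _).trans h.dCentral_eq_one.symm⟩

end CharacteristicClass

section ExtensionKernel

variable {𝕜 : Type*} [RCLike 𝕜]
  {E : Type*} [AddCommGroup E] [Module 𝕜 E] [TopologicalSpace E] [IsTopologicalAddGroup E]
  [ContinuousSMul 𝕜 E] [PolynormableSpace 𝕜 E] [T2Space E]
  {F : Type*} [AddCommGroup F] [Module 𝕜 F] [TopologicalSpace F] [IsTopologicalAddGroup F]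
  [ContinuousSMul 𝕜 F] [PolynormableSpace 𝕜 F] [T2Space F]
  {G : Type*} [Group G] [TopologicalSpace G] [ChartedSpace E G] [IsLieGroup 𝕜 E G]
  {N : Type*} [Group N] [TopologicalSpace N] [ChartedSpace F N]

theorem exists_isFactorSet_of_extKernel_nonempty {S : G → MulAut N}
    (h : (ExtKernel 𝕜 E F S).Nonempty) : ∃ ω : G → G → N, IsC2ss 𝕜 E F ω ∧ IsFactorSet S ω := by
  obtain ⟨_, X, -, hX⟩ := h
  exact hX.exists_isFactorSet

theorem SmoothFactorSystem.extKernel_nonempty [IsLieGroup 𝕜 F N]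
    (A : SmoothFactorSystem 𝕜 E F G N) [IsLieGroup 𝕜 (F × E) A.Crossed] :
    (ExtKernel 𝕜 E F A.S).Nonempty :=
  ⟨_, A.extension, rfl, A.extension_correspondsTo⟩

end ExtensionKernel

theorem mainTheorem1 {𝕜 : Type*} [RCLike 𝕜]
    {E : Type*} [AddCommGroup E] [Module 𝕜 E] [TopologicalSpace E] [IsTopologicalAddGroup E]
    [ContinuousSMul 𝕜 E] [PolynormableSpace 𝕜 E] [T2Space E]
    {F : Type*} [AddCommGroup F] [Module 𝕜 F] [TopologicalSpace F] [IsTopologicalAddGroup F]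
    [ContinuousSMul 𝕜 F] [PolynormableSpace 𝕜 F] [T2Space F]
    {G : Type*} [Group G] [TopologicalSpace G] [ChartedSpace E G] [IsLieGroup 𝕜 E G]
    {N : Type*} [Group N] [TopologicalSpace N] [ChartedSpace F N] [IsLieGroup 𝕜 F N] :
    (∀ (S : G → MulAut N) (hS : IsStronglySmoothOuterAction 𝕜 E F S),
      charClassSs hS = 1 ↔ (ExtKernel 𝕜 E F S).Nonempty) ∧
    (ConnectedSpace G → ∀ (S : G → MulAut N) (hS : IsSmoothOuterAction 𝕜 E F S),
      charClassS hS = 1 ↔ (ExtKernel 𝕜 E F S).Nonempty) := by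
  refine ⟨fun S hS => ?_, fun _ S hS => ?_⟩
  · rw [charClassSs_eq_one_iff]
    refine ⟨fun ⟨ω, hω, hfactor⟩ => ?_, exists_isFactorSet_of_extKernel_nonempty⟩
    let A : SmoothFactorSystem 𝕜 E F G N :=
      { S, ω, isFactorSet := hfactor, isC1Aut := hS.isC1Aut, isC2 := hω.toIsC2 }
    have := A.isLieGroup_of_isC2ss hω
    exact A.extKernel_nonempty
  · rw [charClassS_eq_one_iff]
    refine ⟨fun ⟨ω, hω, hfactor⟩ => ?_, fun h => ?_⟩
    · let A : SmoothFactorSystem 𝕜 E F G N :=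
        { S, ω, isFactorSet := hfactor, isC1Aut := hS.isC1Aut, isC2 := hω }
      have := A.isLieGroup_of_connectedSpace
      exact A.extKernel_nonempty
    · obtain ⟨ω, hω, hfactor⟩ := exists_isFactorSet_of_extKernel_nonempty h
      exact ⟨ω, hω.toIsC2, hfactor⟩
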